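/- Let $\beta\in[0,1)$ and $L\ge 0$. There is $a_0>0$, depending only on $L$ and $\beta$, such that for all $p\in(\tfrac12,1)$, $c_1>0$ and $c_2,M,R\in\mathbb{R}$ there is a constant $C>0$, depending only on $L,\beta,p,c_1,c_2,M,R$, with the following property. Let $d\ge 0$, let $\mathcal{Z}$ be a measurable space (for instance a Borel subset of some $\mathbb{R}^N$) with a probability measure $\nu$ (for instance one with a density), and let $\ell:\mathcal{Z}\times\mathbb{R}^d\to[0,\infty)$ be such that for every $z$ the function $\ell(z,\cdot)$ is convex and differentiable with $L$-Lipschitz gradient (with respect to the Euclidean norm), and for every $w$ the function $\ell(\cdot,w)$ is measurable and $\nu$-integrable and $\nabla_w\ell(\cdot,w)$ is $\nu$-integrable. Put $F(w)=\int\ell(z,w)\,\nu(dz)$ and $F_*=\inf_w F(w)$, and suppose that there is $w_*\in\mathbb{R}^d$ with $F(w_*)=F_*$ and $\sup_z\ell(z,w_*)\le M$. Let $(\alpha_t)_{t\ge0}$ be nonincreasing with $\alpha_0\le a_0$ and $c_1t^{-p}\le\alpha_t\le c_2t^{-p}$ for all $t\ge1$. Let $(Z_t)_{t\ge 0}$ be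 i.i.d. random variables with law $\nu$ on a probability space, let $w_0=w_1\in\mathbb{R}^d$ be deterministic with $\|w_0-w_*\|\le R$, and let $$w_{t+1}=w_t-\alpha_t\nabla_w\ell(Z_t,w_t)+\beta(w_t-w_{t-1}),\qquad t\ge1,$$ be the stochastic heavy ball (SHB) iterates. Then for every integer $T\ge2$ and every $\delta\in(0,1)$, $$\mathbb{P}\left[F(w_{T+1})-F_*\le C\,T^{\max(p-1,\,1-2p)}\left(\log\frac{T}{\delta}\right)^2\right]\ge 1-\delta .$$ -/

import Mathlib

open MeasureTheory ProbabilityTheory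
open scoped NNReal

universe u v

/-- The parameter space `ℝ^d` with its Euclidean norm. -/
abbrev Param (d : ℕ) : Type := EuclideanSpace ℝ (Fin d)

/-- The objective function `F(w) = 𝔼[ℓ(Z, w)]`, where `Z` has law `ν`. -/
noncomputable def risk {𝒵 : Type u} [MeasurableSpace 𝒵] {d : ℕ}
    (ℓ : 𝒵 → Param d → ℝ) (ν : Measure 𝒵) (w : Param d) : ℝ :=
  ∫ z, ℓ z w ∂ν

/-- The optimal value `F_* = inf_w F(w)`. -/
noncomputable def optRisk {𝒵 : Type u} [MeasurableSpace 𝒵] {d : ℕ}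
    (ℓ : 𝒵 → Param d → ℝ) (ν : Measure 𝒵) : ℝ :=
  ⨅ w : Param d, risk ℓ ν w

/-- The assumptions on the loss `ℓ(z, w) ≥ 0`: each `ℓ(z, ·)` is convex and differentiable with
`L`-Lipschitz gradient, and `ℓ(·, w)` and `∇ℓ(·, w)` (gradient in the second variable) are
integrable with respect to the law `ν` of the data. -/
structure IsSmoothConvexLoss {𝒵 : Type u} [MeasurableSpace 𝒵] {d : ℕ}
    (ℓ : 𝒵 → Param d → ℝ) (ν : Measure 𝒵) (L : ℝ≥0) : Prop where
  nonneg : ∀ z w, 0 ≤ ℓ z w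
  measurable : ∀ w, Measurable fun z => ℓ z w
  differentiable : ∀ z, Differentiable ℝ (ℓ z)
  lipschitz_gradient : ∀ z, LipschitzWith L (gradient (ℓ z))
  convex : ∀ z, ConvexOn ℝ Set.univ (ℓ z)
  integrable : ∀ w, Integrable (fun z => ℓ z w) ν
  integrable_gradient : ∀ w, Integrable (fun z => gradient (ℓ z) w) ν

/-- The stochastic heavy ball iterates along a data sequence `Z 0, Z 1, …`, with step sizes `α`,
momentum `β` and deterministic starting point `w₀`:
`w_0 = w_1 = w₀` and `w_{t+1} = w_t - α_t ∇ℓ(Z_t, w_t) + β (w_t - w_{t-1})` for `t ≥ 1`. -/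
noncomputable def shb {𝒵 : Type u} {d : ℕ} (ℓ : 𝒵 → Param d → ℝ)
    (α : ℕ → ℝ) (β : ℝ) (w₀ : Param d) (Z : ℕ → 𝒵) : ℕ → Param d
  | 0 => w₀
  | 1 => w₀
  | t + 2 =>
      shb ℓ α β w₀ Z (t + 1)
        - α (t + 1) • gradient (ℓ (Z (t + 1))) (shb ℓ α β w₀ Z (t + 1))
        + β • (shb ℓ α β w₀ Z (t + 1) - shb ℓ α β w₀ Z t)

/-! Heavy ball is gradient descent in disguise: with c = β/(1-β), the point x = w + c(w - u)
(`auxPoint`) moves by exactly -ηg, where η = α/(1-β) and g is the sample gradient at w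
(`auxPoint_heavyBallStep`). The gradient is taken at w instead of x; that error is governed by ‖w -
u‖², which `lyapunov` carries along.

Two exponential supermartingale arguments do the probabilistic work. Nonnegativity and smoothness
give ‖g‖² ≤ 2Kℓ, so second-order terms are controlled by the loss itself. Along every path the
Lyapunov value V_n is at most ‖w₀ - v‖² + 2MQ_n, with Q_n the sum of the η's (`shbLyapunov_le`).
Since p > 1/2, the product of a step with Q_n stays bounded, hence so does η times V_n, and this is
the boundedness a Bernstein-type estimate requires. As the squares of the steps are summable,
`lintegral_exp_shbLyapunov_le` yields exponential moments of V_n + J_n, where J_n is `shbEnergy`.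
With Λ = log(T/δ), all V_n and J_n with n ≤ T are O(Λ) outside an unlikely event.

For the last iterate, follow Q_n (F(x_n) - F_* + ‖w_{n+1} - w_n‖²) (`stepSum_mul_le`). The growth of
the weight is paid for by J_n, and the second-order terms by O(Λ) times the sum of Qη². The
martingale noise has conditional variance proportional to ‖∇F(x)‖², and descent supplies a matching
negative term; truncated where V is large, the compensated noise is O(Λ²) by
`lintegral_exp_shbNoise_le_one`. Dividing by Q_T, of order at least T^(1-p), gives the rate, and
smoothness leads back from x_T to w_{T+1}. -/

/-! ### Smoothness and convexity inequalities. -/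

section QuadraticUpperBound

variable {E : Type*} [NormedAddCommGroup E] [InnerProductSpace ℝ E]

/-- The descent inequality of a function `f` with (candidate) gradient `G` and curvature `K`. -/
def HasQuadraticUpperBound (f : E → ℝ) (G : E → E) (K : ℝ) : Prop :=
  ∀ x y, f y ≤ f x + inner ℝ (G x) (y - x) + K / 2 * ‖y - x‖ ^ 2

/-- A single gradient step of length 1/K cannot push f below its lower bound m. -/
theorem HasQuadraticUpperBound.norm_sq_le {f : E → ℝ} {G : E → E} {K m : ℝ}
    (h : HasQuadraticUpperBound f G K) (hK : 0 < K) (hm : ∀ x, m ≤ f x) (x : E) :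
    ‖G x‖ ^ 2 ≤ 2 * K * (f x - m) := by
  have h1 := (hm _).trans (h x (x - K⁻¹ • G x))
  rw [show x - K⁻¹ • G x - x = -(K⁻¹ • G x) by abel, inner_neg_right, norm_neg, norm_smul,
    inner_smul_right, real_inner_self_eq_norm_sq, mul_pow, Real.norm_eq_abs, sq_abs] at h1
  have h2 : K / 2 * (K⁻¹ ^ 2 * ‖G x‖ ^ 2) = K⁻¹ * ‖G x‖ ^ 2 / 2 := by
    field_simp
  rw [h2] at h1
  have h3 : K⁻¹ * ‖G x‖ ^ 2 ≤ 2 * (f x - m) := by linarith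
  rw [inv_mul_le_iff₀ hK] at h3
  linarith

/-- Young's inequality on the linear term, combined with `norm_sq_le`. It transports suboptimality
between w, the target and the auxiliary point at the cost of a factor 2. -/
theorem HasQuadraticUpperBound.sub_le_two_mul {f : E → ℝ} {G : E → E} {K m : ℝ}
    (h : HasQuadraticUpperBound f G K) (hK : 0 < K) (hm : ∀ x, m ≤ f x) (x y : E) :
    f y - m ≤ 2 * (f x - m) + K * ‖y - x‖ ^ 2 := by
  have h1 := h x y
  have h2 := h.norm_sq_le hK hm x
  have h3 := real_inner_le_norm (G x) (y - x)
  have h4 : 2 * K * (‖G x‖ * ‖y - x‖) ≤ ‖G x‖ ^ 2 + K ^ 2 * ‖y - x‖ ^ 2 := by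
    nlinarith [sq_nonneg (‖G x‖ - K * ‖y - x‖)]
  have h5 : 2 * K * (‖G x‖ * ‖y - x‖) ≤ 2 * K * (f x - m + K / 2 * ‖y - x‖ ^ 2) := by
    nlinarith
  have h6 := le_of_mul_le_mul_left h5 (by positivity)
  linarith

variable [CompleteSpace E]

/-- The mean value inequality on the segment leaves a remainder L‖y - x‖², without the sharp factor
1/2; hence the requirement 2L ≤ K. -/
theorem hasQuadraticUpperBound_gradient {f : E → ℝ} {L : ℝ≥0} (hf : Differentiable ℝ f)
    (hL : LipschitzWith L (gradient f)) {K : ℝ} (hK : 2 * (L : ℝ) ≤ K) :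
    HasQuadraticUpperBound f (gradient f) K := by
  intro x y
  have key := (convex_segment x y).norm_image_sub_le_of_norm_hasFDerivWithin_le'
    (f := f) (f' := fun w => InnerProductSpace.toDual ℝ E (gradient f w))
    (φ := InnerProductSpace.toDual ℝ E (gradient f x)) (C := L * ‖y - x‖)
    (fun w _ => ((hf w).hasGradientAt).hasFDerivAt.hasFDerivWithinAt)
    (fun w hw => by
      rw [← map_sub, LinearIsometryEquiv.norm_map]
      refine (hL.norm_sub_le w x).trans ?_
      gcongr
      obtain ⟨t, ht, rfl⟩ := (segment_eq_image_lineMap ℝ x y ▸ hw)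
      rw [AffineMap.lineMap_apply_module', add_sub_cancel_right, norm_smul, Real.norm_eq_abs,
        abs_of_nonneg ht.1]
      exact mul_le_of_le_one_left (norm_nonneg _) ht.2)
    (left_mem_segment ℝ x y) (right_mem_segment ℝ x y)
  rw [Real.norm_eq_abs, InnerProductSpace.toDual_apply_apply] at key
  have := le_of_abs_le key
  nlinarith [sq_nonneg ‖y - x‖]

theorem ConvexOn.inner_gradient_le {f : E → ℝ} (hc : ConvexOn ℝ Set.univ f)
    (hf : Differentiable ℝ f) (x y : E) : inner ℝ (gradient f x) (y - x) ≤ f y - f x := by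
  have hconv : ConvexOn ℝ Set.univ (f ∘ AffineMap.lineMap (k := ℝ) x y) := by
    simpa using hc.comp_affineMap (AffineMap.lineMap (k := ℝ) x y)
  have hline : HasDerivAt (AffineMap.lineMap (k := ℝ) x y) (y - x) (0 : ℝ) :=
    AffineMap.hasDerivAt_lineMap
  have hg : HasFDerivAt f (InnerProductSpace.toDual ℝ E (gradient f x))
      (AffineMap.lineMap (k := ℝ) x y 0) := by
    rw [AffineMap.lineMap_apply_zero]
    exact (hf x).hasGradientAt.hasFDerivAt
  have hd := hg.comp_hasDerivAt (0 : ℝ) hline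
  have := hconv.le_slope_of_hasDerivAt (Set.mem_univ 0) (Set.mem_univ 1) one_pos hd
  simpa [slope_def_field] using this

end QuadraticUpperBound

/-! ### Joint measurability of the loss, and the risk as a smooth function. -/

section Measurability

variable {𝒵 : Type u} [MeasurableSpace 𝒵] {d : ℕ} {ℓ : 𝒵 → Param d → ℝ} {ν : Measure 𝒵}
  {L : ℝ≥0}

theorem IsSmoothConvexLoss.measurable_uncurry (h : IsSmoothConvexLoss ℓ ν L) :
    Measurable fun q : 𝒵 × Param d => ℓ q.1 q.2 := by
  have := measurable_uncurry_of_continuous_of_measurable (u := fun (w : Param d) (z : 𝒵) => ℓ z w)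
    (fun z => (h.differentiable z).continuous) h.measurable
  exact this.comp measurable_swap

/-- Each coordinate of the gradient is a limit of difference quotients with increments 1/(n+1),
which are measurable in z. -/
theorem IsSmoothConvexLoss.measurable_gradient (h : IsSmoothConvexLoss ℓ ν L) (w : Param d) :
    Measurable fun z => gradient (ℓ z) w := by
  have hcoord : ∀ i, Measurable fun z => gradient (ℓ z) w i := by
    intro i
    set e : Param d := EuclideanSpace.single i (1 : ℝ)
    have hlim : ∀ z, Filter.Tendsto (fun n : ℕ => ((n : ℝ) + 1) *
        (ℓ z (w + (1 / ((n : ℝ) + 1)) • e) - ℓ z w)) Filter.atTop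
        (nhds (gradient (ℓ z) w i)) := by
      intro z
      have hd : HasLineDerivAt ℝ (ℓ z) (gradient (ℓ z) w i) w e := by
        have h0 := ((h.differentiable z w).hasGradientAt.hasFDerivAt).hasLineDerivAt e
        rw [InnerProductSpace.toDual_apply_apply, EuclideanSpace.inner_single_right] at h0
        simpa only [one_mul, conj_trivial] using h0
      have h1 := hd.tendsto_slope_zero_right
      have h2 : Filter.Tendsto (fun n : ℕ => 1 / ((n : ℝ) + 1)) Filter.atTop
          (nhdsWithin 0 (Set.Ioi 0)) :=
        tendsto_nhdsWithin_iff.2 ⟨tendsto_one_div_add_atTop_nhds_zero_nat,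
          Filter.Eventually.of_forall fun n => by simp only [Set.mem_Ioi]; positivity⟩
      simpa [Function.comp_def] using h1.comp h2
    exact measurable_of_tendsto_metrizable
      (fun n => ((h.measurable _).sub (h.measurable _)).const_mul _) (tendsto_pi_nhds.2 hlim)
  have := (WithLp.measurable_toLp 2 (Fin d → ℝ)).comp (measurable_pi_lambda _ hcoord)
  exact this

theorem IsSmoothConvexLoss.measurable_uncurry_gradient (h : IsSmoothConvexLoss ℓ ν L) :
    Measurable fun q : 𝒵 × Param d => gradient (ℓ q.1) q.2 := by
  have := measurable_uncurry_of_continuous_of_measurable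
    (u := fun (w : Param d) (z : 𝒵) => gradient (ℓ z) w)
    (fun z => (h.lipschitz_gradient z).continuous) h.measurable_gradient
  exact this.comp measurable_swap

/-- The gradient `∇F(w) = 𝔼[∇ℓ(Z, w)]` of the risk. -/
noncomputable def riskGradient (ℓ : 𝒵 → Param d → ℝ) (ν : Measure 𝒵) (w : Param d) : Param d :=
  ∫ z, gradient (ℓ z) w ∂ν

theorem IsSmoothConvexLoss.measurable_risk [SFinite ν] (h : IsSmoothConvexLoss ℓ ν L) :
    Measurable (risk ℓ ν) :=
  (h.measurable_uncurry.comp measurable_swap).stronglyMeasurable.integral_prod_right'.measurable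

theorem IsSmoothConvexLoss.measurable_riskGradient [SFinite ν] (h : IsSmoothConvexLoss ℓ ν L) :
    Measurable (riskGradient ℓ ν) :=
  (h.measurable_uncurry_gradient.comp
    measurable_swap).stronglyMeasurable.integral_prod_right'.measurable

theorem IsSmoothConvexLoss.risk_nonneg (h : IsSmoothConvexLoss ℓ ν L) (w : Param d) :
    0 ≤ risk ℓ ν w := integral_nonneg fun z => h.nonneg z w

theorem IsSmoothConvexLoss.optRisk_le (h : IsSmoothConvexLoss ℓ ν L) (w : Param d) :
    optRisk ℓ ν ≤ risk ℓ ν w :=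
  ciInf_le ⟨0, by rintro _ ⟨w, rfl⟩; exact h.risk_nonneg w⟩ w

theorem IsSmoothConvexLoss.hasQuadraticUpperBound (h : IsSmoothConvexLoss ℓ ν L) {K : ℝ}
    (hK : 2 * (L : ℝ) ≤ K) (z : 𝒵) : HasQuadraticUpperBound (ℓ z) (gradient (ℓ z)) K :=
  hasQuadraticUpperBound_gradient (h.differentiable z) (h.lipschitz_gradient z) hK

theorem IsSmoothConvexLoss.hasQuadraticUpperBound_risk [IsProbabilityMeasure ν]
    (h : IsSmoothConvexLoss ℓ ν L) {K : ℝ} (hK : 2 * (L : ℝ) ≤ K) :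
    HasQuadraticUpperBound (risk ℓ ν) (riskGradient ℓ ν) K := by
  intro x y
  have hinner : Integrable (fun z => inner ℝ (gradient (ℓ z) x) (y - x)) ν :=
    (h.integrable_gradient x).inner_const (y - x)
  have hmono := integral_mono (h.integrable y)
    (((h.integrable x).add hinner).add (integrable_const (K / 2 * ‖y - x‖ ^ 2)))
    (fun z => h.hasQuadraticUpperBound hK z x y)
  have e1 : ∫ z, (((fun z => ℓ z x) + (fun z => inner ℝ (gradient (ℓ z) x) (y - x)) : 𝒵 → ℝ)
      + (fun _ => K / 2 * ‖y - x‖ ^ 2) : 𝒵 → ℝ) z ∂ν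
      = risk ℓ ν x + inner ℝ (riskGradient ℓ ν x) (y - x) + K / 2 * ‖y - x‖ ^ 2 := by
    rw [integral_add' ((h.integrable x).add hinner) (integrable_const _),
      integral_add' (h.integrable x) hinner, integral_const]
    have : ∫ z, inner ℝ (gradient (ℓ z) x) (y - x) ∂ν = inner ℝ (riskGradient ℓ ν x) (y - x) := by
      simp_rw [real_inner_comm (y - x)]
      exact integral_inner (𝕜 := ℝ) (h.integrable_gradient x) (y - x)
    rw [this]
    simp [risk]
  exact hmono.trans_eq e1

theorem IsSmoothConvexLoss.norm_riskGradient_sub_le [IsProbabilityMeasure ν]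
    (h : IsSmoothConvexLoss ℓ ν L) (x y : Param d) :
    ‖riskGradient ℓ ν x - riskGradient ℓ ν y‖ ≤ L * ‖x - y‖ := by
  rw [riskGradient, riskGradient,
    ← integral_sub (h.integrable_gradient x) (h.integrable_gradient y)]
  have := norm_integral_le_of_norm_le_const (μ := ν)
    (f := fun z => gradient (ℓ z) x - gradient (ℓ z) y) (C := L * ‖x - y‖)
    (Filter.Eventually.of_forall fun z => (h.lipschitz_gradient z).norm_sub_le x y)
  simpa using this

end Measurability

/-! ### Exponential moments, fresh samples and Markov's inequality. -/

section Probability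

/-- A uniformly bounded random variable has an exponential moment controlled by its first two
moments. -/
theorem lintegral_exp_le_exp_integral_add {𝒵 : Type*} [MeasurableSpace 𝒵] {ν : Measure 𝒵}
    [IsProbabilityMeasure ν] {X U : 𝒵 → ℝ} (hX : Measurable X) (hX1 : ∀ z, |X z| ≤ 1)
    (hXU : ∀ z, X z ^ 2 ≤ U z) (hU : Integrable U ν) :
    ∫⁻ z, ENNReal.ofReal (Real.exp (X z)) ∂ν
      ≤ ENNReal.ofReal (Real.exp (∫ z, X z ∂ν + ∫ z, U z ∂ν)) := by
  have hXi : Integrable X ν := Integrable.of_bound hX.aestronglyMeasurable 1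
    (Filter.Eventually.of_forall hX1)
  -- On [-1, 1] one has exp x ≤ 1 + x + x². After integration, 1 + y ≤ exp y restores the
  -- exponential.
  have hpt : ∀ z, Real.exp (X z) ≤ 1 + X z + U z := fun z => by
    have := le_of_abs_le (Real.abs_exp_sub_one_sub_id_le (hX1 z))
    linarith [hXU z]
  have hi : Integrable (fun z => 1 + X z + U z) ν := ((integrable_const 1).add hXi).add hU
  calc ∫⁻ z, ENNReal.ofReal (Real.exp (X z)) ∂ν
      ≤ ∫⁻ z, ENNReal.ofReal (1 + X z + U z) ∂ν :=
        lintegral_mono fun z => ENNReal.ofReal_le_ofReal (hpt z)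
    _ = ENNReal.ofReal (∫ z, (1 + X z + U z) ∂ν) :=
        (ofReal_integral_eq_lintegral_ofReal hi
          (Filter.Eventually.of_forall fun z => (Real.exp_pos _).le.trans (hpt z))).symm
    _ ≤ _ := by
        refine ENNReal.ofReal_le_ofReal ?_
        have e : ∫ z, (1 + X z + U z) ∂ν = 1 + (∫ z, X z ∂ν + ∫ z, U z ∂ν) := by
          have h1 : ∫ z, (1 + X z + U z) ∂ν = ∫ z, (1 + X z) ∂ν + ∫ z, U z ∂ν :=
            integral_add ((integrable_const 1).add hXi) hU
          have h2 : ∫ z, (1 + X z) ∂ν = ∫ _, (1 : ℝ) ∂ν + ∫ z, X z ∂ν :=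
            integral_add (integrable_const 1) hXi
          rw [h1, h2]
          simp
          ring
        rw [e, add_comm]
        exact Real.add_one_le_exp _

/-- The `σ`-algebra generated by the data observed strictly before time `t`. -/
@[reducible]
def strictPast {Ω : Type*} {𝒵 : Type*} [MeasurableSpace 𝒵] (Z : ℕ → Ω → 𝒵) (t : ℕ) :
    MeasurableSpace Ω :=
  ⨆ i ∈ Set.Iio t, MeasurableSpace.comap (Z i) inferInstance

variable {Ω : Type*} {𝒵 : Type*} [MeasurableSpace 𝒵] {Z : ℕ → Ω → 𝒵}

theorem strictPast_mono {s t : ℕ} (h : s ≤ t) : strictPast Z s ≤ strictPast Z t :=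
  biSup_mono fun _ hi => lt_of_lt_of_le hi h

theorem measurable_strictPast {s t : ℕ} (h : s < t) : Measurable[strictPast Z t] (Z s) :=
  measurable_iff_comap_le.2 (le_iSup₂_of_le s h le_rfl)

theorem strictPast_le [mΩ : MeasurableSpace Ω] (hZ : ∀ t, Measurable (Z t)) (t : ℕ) :
    strictPast Z t ≤ mΩ :=
  iSup₂_le fun i _ => (hZ i).comap_le

/-- Integrating over a fresh sample first: the past is independent of the current sample. -/
theorem lintegral_strictPast [mΩ : MeasurableSpace Ω] {P : Measure Ω} [IsProbabilityMeasure P]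
    {ν : Measure 𝒵} [IsProbabilityMeasure ν]
    (hZ : ∀ t, Measurable (Z t)) (hind : iIndepFun Z P) (hlaw : ∀ t, P.map (Z t) = ν) {t : ℕ}
    {E : Type*} [MeasurableSpace E] {X : Ω → E} (hX : Measurable[strictPast Z t] X)
    {f : E × 𝒵 → ENNReal} (hf : Measurable f) :
    ∫⁻ ω, f (X ω, Z t ω) ∂P = ∫⁻ ω, ∫⁻ z, f (X ω, z) ∂ν ∂P := by
  have hX' : Measurable X := hX.mono (strictPast_le hZ t) le_rfl
  have hindep : IndepFun X (Z t) P := by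
    have h1 := indep_iSup_of_disjoint (fun i => (hZ i).comap_le) hind
      (S := Set.Iio t) (T := {t}) (by simp)
    have h2 : (⨆ i ∈ ({t} : Set ℕ), MeasurableSpace.comap (Z i) inferInstance)
        = MeasurableSpace.comap (Z t) inferInstance := by simp
    rw [h2] at h1
    exact indep_of_indep_of_le_left h1 (measurable_iff_comap_le.1 hX)
  have hmap := (indepFun_iff_map_prod_eq_prod_map_map hX'.aemeasurable
    (hZ t).aemeasurable).1 hindep
  rw [hlaw t] at hmap
  calc ∫⁻ ω, f (X ω, Z t ω) ∂P
      = ∫⁻ q, f q ∂(P.map fun ω => (X ω, Z t ω)) :=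
        (lintegral_map hf (hX'.prodMk (hZ t))).symm
    _ = ∫⁻ x, ∫⁻ z, f (x, z) ∂ν ∂(P.map X) := by
        rw [hmap, lintegral_prod _ hf.aemeasurable]
    _ = _ := lintegral_map hf.lintegral_prod_right' hX'

/-- Conditionally on the past, an exponential increment driven by the current sample may be replaced
by a bound for its integral over a fresh sample. -/
theorem lintegral_exp_add_strictPast_le [mΩ : MeasurableSpace Ω] {P : Measure Ω}
    [IsProbabilityMeasure P] {ν : Measure 𝒵} [IsProbabilityMeasure ν]
    (hZ : ∀ t, Measurable (Z t)) (hind : iIndepFun Z P) (hlaw : ∀ t, P.map (Z t) = ν) {t : ℕ}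
    {E : Type*} [MeasurableSpace E] {X : Ω → E} (hX : Measurable[strictPast Z t] X)
    {J : Ω → ℝ} (hJ : Measurable[strictPast Z t] J) {φ : E × 𝒵 → ℝ} (hφ : Measurable φ)
    {b : Ω → ℝ}
    (hb : ∀ ω, ∫⁻ z, ENNReal.ofReal (Real.exp (φ (X ω, z))) ∂ν
      ≤ ENNReal.ofReal (Real.exp (b ω))) :
    ∫⁻ ω, ENNReal.ofReal (Real.exp (J ω + φ (X ω, Z t ω))) ∂P
      ≤ ∫⁻ ω, ENNReal.ofReal (Real.exp (J ω + b ω)) ∂P := by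
  have hf : Measurable fun q : (E × ℝ) × 𝒵 => ENNReal.ofReal (Real.exp q.1.2)
      * ENNReal.ofReal (Real.exp (φ (q.1.1, q.2))) :=
    (Real.measurable_exp.comp measurable_fst.snd).ennreal_ofReal.mul
      (Real.measurable_exp.comp (hφ.comp
        (measurable_fst.fst.prodMk measurable_snd))).ennreal_ofReal
  have hsplit := lintegral_strictPast hZ hind hlaw (hX.prodMk hJ) hf
  simp only [Real.exp_add, ENNReal.ofReal_mul (Real.exp_pos _).le]
  rw [hsplit]
  refine lintegral_mono fun ω => ?_
  dsimp only
  rw [lintegral_const_mul' _ _ ENNReal.ofReal_ne_top]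
  exact mul_le_mul_right (hb ω) _

/-- Markov's inequality for exponential moments. -/
theorem measure_lt_le_of_lintegral_exp_le [MeasurableSpace Ω] {P : Measure Ω} {A : Ω → ℝ}
    (hA : Measurable A) {b x : ℝ}
    (h : ∫⁻ ω, ENNReal.ofReal (Real.exp (A ω)) ∂P ≤ ENNReal.ofReal (Real.exp b)) :
    P {ω | x < A ω} ≤ ENNReal.ofReal (Real.exp (b - x)) := by
  have hm : Measurable fun ω => ENNReal.ofReal (Real.exp (A ω)) :=
    (Real.measurable_exp.comp hA).ennreal_ofReal
  have h1 := mul_meas_ge_le_lintegral (μ := P) hm (ENNReal.ofReal (Real.exp x))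
  have h2 : {ω | x < A ω}
      ⊆ {ω | ENNReal.ofReal (Real.exp x) ≤ ENNReal.ofReal (Real.exp (A ω))} := fun ω hω =>
    ENNReal.ofReal_le_ofReal (Real.exp_le_exp.2 (le_of_lt hω))
  have h3 : ENNReal.ofReal (Real.exp x) * P {ω | x < A ω} ≤ ENNReal.ofReal (Real.exp b) :=
    (mul_le_mul_right (measure_mono h2) _).trans (h1.trans h)
  have hx0 : ENNReal.ofReal (Real.exp x) ≠ 0 := by simp [Real.exp_pos]
  rw [Real.exp_sub, ENNReal.ofReal_div_of_pos (Real.exp_pos x),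
    ENNReal.le_div_iff_mul_le (Or.inl hx0) (Or.inl ENNReal.ofReal_ne_top), mul_comm]
  exact h3

end Probability

/-! ### Deterministic heavy ball step and its Lyapunov function. -/

section Dynamics

variable {E : Type*} [NormedAddCommGroup E] [InnerProductSpace ℝ E]

/-- One step of the heavy ball method from `(u, w)` with step size `α` and direction `g`. -/
def heavyBallStep (α β : ℝ) (u w g : E) : E := w - α • g + β • (w - u)

/-- The auxiliary point `w + β / (1 - β) (w - u)`, which moves by plain gradient steps. -/
noncomputable def auxPoint (β : ℝ) (u w : E) : E := w + (β / (1 - β)) • (w - u)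

/-- The Lyapunov function of the heavy ball method with target `v`. -/
noncomputable def lyapunov (β : ℝ) (v u w : E) : ℝ :=
  ‖auxPoint β u w - v‖ ^ 2 + 2 / (1 - β) * ‖w - u‖ ^ 2

theorem auxPoint_heavyBallStep {β : ℝ} (hβ : β < 1) (α : ℝ) (u w g : E) :
    auxPoint β w (heavyBallStep α β u w g) = auxPoint β u w - (α / (1 - β)) • g := by
  have hb : 1 - β ≠ 0 := by linarith
  simp only [auxPoint, heavyBallStep]
  match_scalars <;> field_simp <;> ring

/-- The new displacement is the convex combination, with weights β and 1-β, of the old displacement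
and -ηg; the squared norm is convex. -/
theorem norm_sq_heavyBallStep_sub_le {β : ℝ} (hβ₀ : 0 ≤ β) (hβ : β < 1) (α : ℝ) (u w g : E) :
    ‖heavyBallStep α β u w g - w‖ ^ 2
      ≤ β * ‖w - u‖ ^ 2 + (1 - β) * (α / (1 - β)) ^ 2 * ‖g‖ ^ 2 := by
  have hb : 0 < 1 - β := by linarith
  have e : heavyBallStep α β u w g - w
      = β • (w - u) + (1 - β) • (-((α / (1 - β)) • g)) := by
    simp only [heavyBallStep]
    match_scalars <;> field_simp
    ring
  have hn : ‖heavyBallStep α β u w g - w‖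
      ≤ β * ‖w - u‖ + (1 - β) * (|α / (1 - β)| * ‖g‖) := by
    rw [e]
    refine (norm_add_le _ _).trans_eq ?_
    rw [norm_smul, norm_smul, norm_neg, norm_smul, Real.norm_of_nonneg hβ₀,
      Real.norm_of_nonneg hb.le, Real.norm_eq_abs]
  have hsq : (β * ‖w - u‖ + (1 - β) * (|α / (1 - β)| * ‖g‖)) ^ 2
      ≤ β * ‖w - u‖ ^ 2 + (1 - β) * (|α / (1 - β)| * ‖g‖) ^ 2 := by
    nlinarith [mul_nonneg (mul_nonneg hβ₀ hb.le)
      (sq_nonneg (‖w - u‖ - |α / (1 - β)| * ‖g‖))]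
  rw [mul_pow, sq_abs] at hsq
  have := pow_le_pow_left₀ (norm_nonneg _) hn 2
  nlinarith

theorem lyapunov_nonneg {β : ℝ} (hβ : β < 1) (v u w : E) : 0 ≤ lyapunov β v u w := by
  have hb : 0 < 1 - β := by linarith
  unfold lyapunov
  positivity

/-- The weight 2/(1-β) makes the kinetic part lose 2‖w - u‖² per step. One of these two units pays,
by Young, for the cross term between g and w - u; the other remains as a gain. The factor 3 +
(β/(1-β))² collects 1 from the square, 2 from the kinetic part and the rest from Young. -/
theorem lyapunov_heavyBallStep_le {β : ℝ} (hβ₀ : 0 ≤ β) (hβ : β < 1) (α : ℝ) (v u w g : E) :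
    lyapunov β v w (heavyBallStep α β u w g)
      ≤ lyapunov β v u w - ‖w - u‖ ^ 2 - 2 * (α / (1 - β)) * inner ℝ g (w - v)
        + (3 + (β / (1 - β)) ^ 2) * (α / (1 - β)) ^ 2 * ‖g‖ ^ 2 := by
  have hb : 0 < 1 - β := by linarith
  have hm := norm_sq_heavyBallStep_sub_le hβ₀ hβ α u w g
  unfold lyapunov
  rw [auxPoint_heavyBallStep hβ]
  set η := α / (1 - β)
  have e1 : ‖auxPoint β u w - η • g - v‖ ^ 2 = ‖auxPoint β u w - v‖ ^ 2
      - 2 * η * inner ℝ g (w - v) - 2 * η * (β / (1 - β)) * inner ℝ g (w - u)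
      + η ^ 2 * ‖g‖ ^ 2 := by
    rw [show auxPoint β u w - η • g - v = (auxPoint β u w - v) - η • g by abel,
      norm_sub_sq_real, inner_smul_right, norm_smul, mul_pow, Real.norm_eq_abs, sq_abs,
      real_inner_comm,
      show auxPoint β u w - v = (w - v) + (β / (1 - β)) • (w - u) by
        simp only [auxPoint]; abel,
      inner_add_right, inner_smul_right]
    ring
  have e2 : -(2 * η * (β / (1 - β)) * inner ℝ g (w - u))
      ≤ (β / (1 - β)) ^ 2 * η ^ 2 * ‖g‖ ^ 2 + ‖w - u‖ ^ 2 := by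
    have h0 := sq_nonneg ‖(η * (β / (1 - β))) • g + (w - u)‖
    rw [norm_add_sq_real, real_inner_smul_left, norm_smul, mul_pow, Real.norm_eq_abs,
      sq_abs] at h0
    nlinarith
  have e3 : 2 / (1 - β) * ‖heavyBallStep α β u w g - w‖ ^ 2
      ≤ 2 / (1 - β) * ‖w - u‖ ^ 2 - 2 * ‖w - u‖ ^ 2 + 2 * η ^ 2 * ‖g‖ ^ 2 := by
    have h1 : 2 / (1 - β) * ‖heavyBallStep α β u w g - w‖ ^ 2 ≤
      2 / (1 - β) * (β * ‖w - u‖ ^ 2 + (1 - β) * η ^ 2 * ‖g‖ ^ 2) := by gcongr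
    refine h1.trans_eq ?_
    field_simp
    ring
  rw [e1]
  nlinarith

theorem norm_sub_sq_le_lyapunov {β : ℝ} (hβ₀ : 0 ≤ β) (hβ : β < 1) (v u w : E) :
    ‖w - v‖ ^ 2 ≤ (2 + (β / (1 - β)) ^ 2) * lyapunov β v u w := by
  have hb : 0 < 1 - β := by linarith
  have h2 : 2 ≤ 2 / (1 - β) := by rw [le_div_iff₀ hb]; linarith
  have e : w - v = (auxPoint β u w - v) - (β / (1 - β)) • (w - u) := by
    simp only [auxPoint]; abel
  have h1 : ‖w - v‖ ≤ ‖auxPoint β u w - v‖ + (β / (1 - β)) * ‖w - u‖ := by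
    rw [e]
    refine (norm_sub_le _ _).trans_eq ?_
    rw [norm_smul, Real.norm_of_nonneg (div_nonneg hβ₀ hb.le)]
  have h3 := pow_le_pow_left₀ (norm_nonneg _) h1 2
  set c := β / (1 - β)
  set A := ‖auxPoint β u w - v‖ with hA
  set m := ‖w - u‖ with hm
  have h4 : (A + c * m) ^ 2 ≤ 2 * A ^ 2 + 2 * c ^ 2 * m ^ 2 := by
    nlinarith [sq_nonneg (A - c * m)]
  have h5 : A ^ 2 + 2 * m ^ 2 ≤ lyapunov β v u w := by
    unfold lyapunov
    rw [← hA, ← hm]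
    nlinarith [sq_nonneg m]
  nlinarith [sq_nonneg c, sq_nonneg A, sq_nonneg m, mul_nonneg (sq_nonneg c) (sq_nonneg A),
    mul_le_mul_of_nonneg_left h5 (by positivity : 0 ≤ 2 + c ^ 2)]

end Dynamics

/-! ### One stochastic step: growth, drift and exponential moments. -/

section OneStep

variable {𝒵 : Type u} [MeasurableSpace 𝒵] {d : ℕ} {ℓ : 𝒵 → Param d → ℝ} {ν : Measure 𝒵}
  {L : ℝ≥0} {β K M : ℝ} {v : Param d}

/-- The constant `k` in the growth bound `ℓ(z, w) ≤ k (1 + V)`, where `V` is the Lyapunov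
function. -/
noncomputable def growthConst (β K M : ℝ) : ℝ := 2 * M + K * (2 + (β / (1 - β)) ^ 2)

/-- The constant `a` in the one-step inequality
`V' ≤ V - 2 η (ℓ(z, w) - ℓ(z, v)) + 2 a η² ℓ(z, w)`. -/
noncomputable def curvConst (β K : ℝ) : ℝ := (3 + (β / (1 - β)) ^ 2) * K

theorem curvConst_pos (hK : 0 < K) : 0 < curvConst β K := by
  unfold curvConst; positivity

theorem growthConst_pos (hK : 0 < K) (hM : 0 ≤ M) : 0 < growthConst β K M := by
  unfold growthConst; positivity

theorem le_growthConst_mul {q V x : ℝ} (hK : 0 < K) (hM : 0 ≤ M) (hV : 0 ≤ V)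
    (hq : q ≤ 2 * M + K * x) (hx : x ≤ (2 + (β / (1 - β)) ^ 2) * V) :
    q ≤ growthConst β K M * (1 + V) := by
  have h1 := mul_le_mul_of_nonneg_left hx hK.le
  have h2 : 0 ≤ K * (2 + (β / (1 - β)) ^ 2) := by positivity
  have h3 : 0 ≤ 2 * M * V := by positivity
  unfold growthConst
  nlinarith

theorem IsSmoothConvexLoss.loss_le_growth (h : IsSmoothConvexLoss ℓ ν L) (hβ₀ : 0 ≤ β)
    (hβ : β < 1) (hLK : 2 * (L : ℝ) ≤ K) (hK : 0 < K) (hM : 0 ≤ M) (hv : ∀ z, ℓ z v ≤ M)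
    (z : 𝒵) (u w : Param d) :
    ℓ z w ≤ growthConst β K M * (1 + lyapunov β v u w) := by
  have h1 := (h.hasQuadraticUpperBound hLK z).sub_le_two_mul hK (h.nonneg z) v w
  have h2 := hv z
  exact le_growthConst_mul hK hM (lyapunov_nonneg hβ v u w) (by linarith)
    (norm_sub_sq_le_lyapunov hβ₀ hβ v u w)

theorem IsSmoothConvexLoss.norm_gradient_sq_le_growth (h : IsSmoothConvexLoss ℓ ν L)
    (hβ₀ : 0 ≤ β) (hβ : β < 1) (hLK : 2 * (L : ℝ) ≤ K) (hK : 0 < K) (hM : 0 ≤ M)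
    (hv : ∀ z, ℓ z v ≤ M) (z : 𝒵) (u w : Param d) :
    ‖gradient (ℓ z) w‖ ^ 2
      ≤ 2 * K * growthConst β K M * (1 + lyapunov β v u w) := by
  have h1 := (h.hasQuadraticUpperBound hLK z).norm_sq_le hK (h.nonneg z) w
  have h2 := h.loss_le_growth hβ₀ hβ hLK hK hM hv z u w
  nlinarith

/-- Convexity of the sample loss handles the inner product, and ‖g‖² ≤ 2Kℓ turns the quadratic term
into a multiple of the loss. -/
theorem IsSmoothConvexLoss.lyapunov_step_le (h : IsSmoothConvexLoss ℓ ν L)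
    (hβ₀ : 0 ≤ β) (hβ : β < 1) (hLK : 2 * (L : ℝ) ≤ K) (hK : 0 < K) {α : ℝ} (hα : 0 ≤ α)
    (z : 𝒵) (u w : Param d) :
    lyapunov β v w (heavyBallStep α β u w (gradient (ℓ z) w))
      ≤ lyapunov β v u w - ‖w - u‖ ^ 2 - 2 * (α / (1 - β)) * (ℓ z w - ℓ z v)
        + 2 * curvConst β K * (α / (1 - β)) ^ 2 * ℓ z w := by
  have hη : 0 ≤ α / (1 - β) := div_nonneg hα (by linarith)
  refine (lyapunov_heavyBallStep_le hβ₀ hβ α v u w _).trans ?_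
  have h1 : ‖gradient (ℓ z) w‖ ^ 2 ≤ 2 * K * ℓ z w := by
    simpa using (h.hasQuadraticUpperBound hLK z).norm_sq_le hK (h.nonneg z) w
  have h2 : ℓ z w - ℓ z v ≤ inner ℝ (gradient (ℓ z) w) (w - v) := by
    have := (h.convex z).inner_gradient_le (h.differentiable z) w v
    rw [← neg_sub w v, inner_neg_right] at this
    linarith
  have h3 := mul_le_mul_of_nonneg_left h1
    (by positivity : 0 ≤ (3 + (β / (1 - β)) ^ 2) * (α / (1 - β)) ^ 2)
  have h4 := mul_le_mul_of_nonneg_left h2 (by positivity : 0 ≤ 2 * (α / (1 - β)))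
  unfold curvConst
  linarith

/-- For small steps the term in η²ℓ(z, w) is absorbed by -2ηℓ(z, w), leaving only the loss at the
target. The bound holds for each sample, not just on average. -/
theorem IsSmoothConvexLoss.lyapunov_step_le_add (h : IsSmoothConvexLoss ℓ ν L)
    (hβ₀ : 0 ≤ β) (hβ : β < 1) (hLK : 2 * (L : ℝ) ≤ K) (hK : 0 < K)
    (hv : ∀ z, ℓ z v ≤ M) {α : ℝ} (hα : 0 ≤ α) (haα : curvConst β K * (α / (1 - β)) ≤ 1 / 4)
    (z : 𝒵) (u w : Param d) :
    lyapunov β v w (heavyBallStep α β u w (gradient (ℓ z) w))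
      ≤ lyapunov β v u w + 2 * (α / (1 - β)) * M := by
  have hη : 0 ≤ α / (1 - β) := div_nonneg hα (by linarith)
  refine (h.lyapunov_step_le hβ₀ hβ hLK hK hα z u w).trans ?_
  have h1 := mul_le_mul_of_nonneg_left (hv z) hη
  have h2 := mul_le_mul_of_nonneg_right haα (mul_nonneg hη (h.nonneg z w))
  nlinarith [sq_nonneg ‖w - u‖, mul_nonneg hη (h.nonneg z w)]

variable [IsProbabilityMeasure ν]

theorem IsSmoothConvexLoss.risk_le (h : IsSmoothConvexLoss ℓ ν L) (hv : ∀ z, ℓ z v ≤ M) :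
    risk ℓ ν v ≤ M := by
  have := integral_mono (h.integrable v) (integrable_const M) hv
  simpa [risk] using this

theorem IsSmoothConvexLoss.risk_le_growth (h : IsSmoothConvexLoss ℓ ν L) (hβ₀ : 0 ≤ β)
    (hβ : β < 1) (hLK : 2 * (L : ℝ) ≤ K) (hK : 0 < K) (hM : 0 ≤ M) (hv : ∀ z, ℓ z v ≤ M)
    (u w : Param d) :
    risk ℓ ν w ≤ growthConst β K M * (1 + lyapunov β v u w) := by
  have h1 := (h.hasQuadraticUpperBound_risk hLK).sub_le_two_mul hK h.risk_nonneg v w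
  have h2 := h.risk_le hv
  exact le_growthConst_mul hK hM (lyapunov_nonneg hβ v u w) (by linarith)
    (norm_sub_sq_le_lyapunov hβ₀ hβ v u w)

theorem IsSmoothConvexLoss.risk_auxPoint_le_growth (h : IsSmoothConvexLoss ℓ ν L)
    (hβ : β < 1) (hLK : 2 * (L : ℝ) ≤ K) (hK : 0 < K) (hM : 0 ≤ M) (hv : ∀ z, ℓ z v ≤ M)
    (u w : Param d) :
    risk ℓ ν (auxPoint β u w) ≤ growthConst β K M * (1 + lyapunov β v u w) := by
  have h1 := (h.hasQuadraticUpperBound_risk hLK).sub_le_two_mul hK h.risk_nonneg v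
    (auxPoint β u w)
  have h2 := h.risk_le hv
  have hb : 0 < 1 - β := by linarith
  have h3 : ‖auxPoint β u w - v‖ ^ 2 ≤ lyapunov β v u w := by
    unfold lyapunov
    have : 0 ≤ 2 / (1 - β) * ‖w - u‖ ^ 2 := by positivity
    linarith
  refine le_growthConst_mul hK hM (lyapunov_nonneg hβ v u w) (by linarith) (h3.trans ?_)
  nlinarith [sq_nonneg (β / (1 - β)), lyapunov_nonneg hβ v u w,
    mul_nonneg (sq_nonneg (β / (1 - β))) (lyapunov_nonneg hβ v u w)]

theorem IsSmoothConvexLoss.norm_riskGradient_sq_le_growth (h : IsSmoothConvexLoss ℓ ν L)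
    (hβ₀ : 0 ≤ β) (hβ : β < 1) (hLK : 2 * (L : ℝ) ≤ K) (hK : 0 < K) (hM : 0 ≤ M)
    (hv : ∀ z, ℓ z v ≤ M) (u w : Param d) :
    ‖riskGradient ℓ ν w‖ ^ 2
      ≤ 2 * K * growthConst β K M * (1 + lyapunov β v u w) := by
  have h1 := (h.hasQuadraticUpperBound_risk hLK).norm_sq_le hK h.risk_nonneg w
  have h2 := h.risk_le_growth hβ₀ hβ hLK hK hM hv u w
  nlinarith

theorem IsSmoothConvexLoss.norm_riskGradient_auxPoint_sq_le_growth
    (h : IsSmoothConvexLoss ℓ ν L)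
    (hβ : β < 1) (hLK : 2 * (L : ℝ) ≤ K) (hK : 0 < K) (hM : 0 ≤ M)
    (hv : ∀ z, ℓ z v ≤ M) (u w : Param d) :
    ‖riskGradient ℓ ν (auxPoint β u w)‖ ^ 2
      ≤ 2 * K * growthConst β K M * (1 + lyapunov β v u w) := by
  have h1 := (h.hasQuadraticUpperBound_risk hLK).norm_sq_le hK h.risk_nonneg (auxPoint β u w)
  have h2 := h.risk_auxPoint_le_growth hβ hLK hK hM hv u w
  nlinarith

/-- Exponential moment of the one-step change of the Lyapunov function. -/
theorem IsSmoothConvexLoss.lintegral_exp_lyapunov_step_le (h : IsSmoothConvexLoss ℓ ν L)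
    (hβ₀ : 0 ≤ β) (hβ : β < 1) (hLK : 2 * (L : ℝ) ≤ K) (hK : 0 < K) (hM : 0 ≤ M)
    (hv : ∀ z, ℓ z v ≤ M) (hmin : ∀ w, risk ℓ ν v ≤ risk ℓ ν w) {α r : ℝ} (hα : 0 ≤ α)
    (haα : curvConst β K * (α / (1 - β)) ≤ 1 / 4) (hr : 0 ≤ r) (u w : Param d)
    (hsmall : 18 * r * (α / (1 - β)) * growthConst β K M * (1 + lyapunov β v u w) ≤ 1) :
    ∫⁻ z, ENNReal.ofReal (Real.exp (r *
        (lyapunov β v w (heavyBallStep α β u w (gradient (ℓ z) w)) + ‖w - u‖ ^ 2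
          + α / (1 - β) * (risk ℓ ν w - risk ℓ ν v) - lyapunov β v u w))) ∂ν
      ≤ ENNReal.ofReal (Real.exp (r * (α / (1 - β)) ^ 2 *
          (2 * curvConst β K * M
            + 12 * r * growthConst β K M * M * (1 + lyapunov β v u w)))) := by
  have hη : 0 ≤ α / (1 - β) := div_nonneg hα (by linarith)
  have hstep := fun z => h.lyapunov_step_le (v := v) hβ₀ hβ hLK hK hα z u w
  have hf := fun z => h.loss_le_growth hβ₀ hβ hLK hK hM hv z u w
  have hF := h.risk_le_growth hβ₀ hβ hLK hK hM hv u w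
  have hV := lyapunov_nonneg hβ v u w
  have ha := curvConst_pos (β := β) hK
  have hkpos := growthConst_pos (β := β) hK hM
  have hMk : M ≤ growthConst β K M * (1 + lyapunov β v u w) := by
    unfold growthConst
    have : 0 ≤ K * (2 + (β / (1 - β)) ^ 2) := by positivity
    nlinarith
  set η := α / (1 - β)
  set a := curvConst β K
  set V := lyapunov β v u w
  set D := risk ℓ ν w - risk ℓ ν v with hD
  set S := risk ℓ ν v with hS
  set k := growthConst β K M * (1 + V) with hk
  have hk0 : 0 ≤ k := by positivity
  have hD0 : 0 ≤ D := sub_nonneg.2 (hmin w)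
  have hS0 : 0 ≤ S := h.risk_nonneg v
  have hSM : S ≤ M := h.risk_le hv
  have hDk : D ≤ k := by linarith
  have hsmall' : 18 * (r * η * k) ≤ 1 := by linarith
  have hrη : 0 ≤ r * η := mul_nonneg hr hη
  -- ηY dominates the quantity in the exponent. Bounding Y² by sup|Y| times A, which is linear in
  -- the losses, makes the variance proxy affine in the suboptimality D.
  set Y : 𝒵 → ℝ := fun z => -2 * (1 - a * η) * ℓ z w + 2 * ℓ z v + D with hY
  set A : 𝒵 → ℝ := fun z => 2 * ℓ z v + D + 2 * ℓ z w with hA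
  have hYA : ∀ z, |Y z| ≤ A z := fun z => by
    have h1 := h.nonneg z v
    have h2 := h.nonneg z w
    have h3 := mul_nonneg (mul_nonneg ha.le hη) h2
    have h4 := mul_le_mul_of_nonneg_right haα h2
    rw [abs_le]
    constructor <;> simp only [hY, hA] <;> nlinarith
  have hY3 : ∀ z, |Y z| ≤ 3 * k := fun z => by
    have h1 := h.nonneg z v
    have h2 := h.nonneg z w
    have h3 := mul_nonneg (mul_nonneg ha.le hη) h2
    have h4 := mul_le_mul_of_nonneg_right haα h2
    have h5 := hf z
    have h6 := hv z
    rw [abs_le]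
    constructor <;> simp only [hY] <;> nlinarith
  have hYm : Measurable Y :=
    (((h.measurable w).const_mul _).add ((h.measurable v).const_mul _)).add_const _
  have hAint : Integrable A ν :=
    (((h.integrable v).const_mul 2).add (integrable_const D)).add ((h.integrable w).const_mul 2)
  have hYint : ∫ z, Y z ∂ν = -2 * (1 - a * η) * (S + D) + 2 * S + D := by
    have e1 : ∫ z, Y z ∂ν = ∫ z, (-2 * (1 - a * η) * ℓ z w + 2 * ℓ z v) ∂ν + ∫ _, D ∂ν :=
      integral_add (((h.integrable w).const_mul _).add ((h.integrable v).const_mul _))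
        (integrable_const D)
    have e2 : ∫ z, (-2 * (1 - a * η) * ℓ z w + 2 * ℓ z v) ∂ν
        = ∫ z, -2 * (1 - a * η) * ℓ z w ∂ν + ∫ z, 2 * ℓ z v ∂ν :=
      integral_add ((h.integrable w).const_mul _) ((h.integrable v).const_mul _)
    have e3 : S + D = risk ℓ ν w := by simp [hD]
    rw [e1, e2, integral_const_mul, integral_const_mul, integral_const, e3]
    simp [risk, hS]
  have hAval : ∫ z, A z ∂ν = 3 * D + 4 * S := by
    have e1 : ∫ z, A z ∂ν = ∫ z, (2 * ℓ z v + D) ∂ν + ∫ z, 2 * ℓ z w ∂ν :=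
      integral_add (((h.integrable v).const_mul 2).add (integrable_const D))
        ((h.integrable w).const_mul 2)
    have e2 : ∫ z, (2 * ℓ z v + D) ∂ν = ∫ z, 2 * ℓ z v ∂ν + ∫ _, D ∂ν :=
      integral_add ((h.integrable v).const_mul 2) (integrable_const D)
    have e3 : ∫ z, ℓ z w ∂ν = S + D := by simp [hD, risk]
    have e4 : ∫ z, ℓ z v ∂ν = S := rfl
    rw [e1, e2, integral_const_mul, integral_const_mul, integral_const, e3, e4]
    simp
    ring
  have hmain := lintegral_exp_le_exp_integral_add (ν := ν) (X := fun z => r * η * Y z)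
    (U := fun z => (r * η) ^ 2 * (3 * k) * A z) (hYm.const_mul _)
    (fun z => by
      rw [abs_mul, abs_of_nonneg hrη]
      have := mul_le_mul_of_nonneg_left (hY3 z) hrη
      nlinarith [mul_nonneg hrη hk0])
    (fun z => by
      have h1 : Y z ^ 2 ≤ 3 * k * A z := by
        rw [← sq_abs, sq]
        exact mul_le_mul (hY3 z) (hYA z) (abs_nonneg _) (by positivity)
      have := mul_le_mul_of_nonneg_left h1 (sq_nonneg (r * η))
      calc (r * η * Y z) ^ 2 = (r * η) ^ 2 * Y z ^ 2 := by ring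
        _ ≤ _ := this
        _ = _ := by ring)
    (hAint.const_mul _)
  refine (lintegral_mono fun z => ENNReal.ofReal_le_ofReal (Real.exp_le_exp.2 ?_)).trans
    (hmain.trans (ENNReal.ofReal_le_ofReal (Real.exp_le_exp.2 ?_)))
  · have h1 := mul_le_mul_of_nonneg_left (hstep z) hr
    simp only [hY]
    nlinarith
  · rw [integral_const_mul, integral_const_mul, hYint, hAval]
    have h1 : -2 * (1 - a * η) * (S + D) + 2 * S + D ≤ -(D / 2) + 2 * a * η * M := by
      have := mul_le_mul_of_nonneg_right haα hD0
      have := mul_le_mul_of_nonneg_left hSM (mul_nonneg ha.le hη)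
      nlinarith
    -- The constant 18 is chosen here: the variance contributes 9rηkD ≤ D/2, exactly the negative
    -- drift left by `h1`.
    have h2 : r * η * (3 * k) * (3 * D + 4 * S) ≤ D / 2 + 12 * (r * η * k) * M := by
      have := mul_le_mul_of_nonneg_right hsmall' hD0
      have := mul_le_mul_of_nonneg_left hSM (mul_nonneg hrη hk0)
      nlinarith
    have h3 := mul_le_mul_of_nonneg_left (add_le_add h1 h2) hrη
    calc _ = r * η * (-2 * (1 - a * η) * (S + D) + 2 * S + D
          + r * η * (3 * k) * (3 * D + 4 * S)) := by ring
      _ ≤ _ := h3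
      _ = _ := by rw [hk]; ring

/-- Exponential moment of the gradient noise, compensated by the squared gradient norm. -/
theorem IsSmoothConvexLoss.lintegral_exp_noise_le_one (h : IsSmoothConvexLoss ℓ ν L)
    (hβ₀ : 0 ≤ β) (hβ : β < 1) (hLK : 2 * (L : ℝ) ≤ K) (hK : 0 < K) (hM : 0 ≤ M)
    (hv : ∀ z, ℓ z v ≤ M) {q B : ℝ} (hq : 0 ≤ q) (u w : Param d)
    (hB : 1 + lyapunov β v u w ≤ B) (hsmall : 16 * q * K * growthConst β K M * B ≤ 1) :
    ∫⁻ z, ENNReal.ofReal (Real.exp (q *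
        (-inner ℝ (riskGradient ℓ ν (auxPoint β u w)) (gradient (ℓ z) w - riskGradient ℓ ν w)
          - 1 / 2 * ‖riskGradient ℓ ν (auxPoint β u w)‖ ^ 2))) ∂ν ≤ 1 := by
  have hkpos := growthConst_pos (β := β) hK hM
  have hBk := mul_le_mul_of_nonneg_left hB
    (by positivity : 0 ≤ 2 * K * growthConst β K M)
  have hg := fun z => (h.norm_gradient_sq_le_growth hβ₀ hβ hLK hK hM hv z u w).trans hBk
  have hGw := (h.norm_riskGradient_sq_le_growth hβ₀ hβ hLK hK hM hv u w).trans hBk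
  have hGz := (h.norm_riskGradient_auxPoint_sq_le_growth hβ hLK hK hM hv u w).trans hBk
  set s := 2 * K * growthConst β K M * B with hs
  set G := riskGradient ℓ ν (auxPoint β u w)
  set ξ : 𝒵 → Param d := fun z => gradient (ℓ z) w - riskGradient ℓ ν w with hξ
  have hξs : ∀ z, ‖ξ z‖ ^ 2 ≤ 4 * s := fun z => by
    have h1 := norm_sub_le (gradient (ℓ z) w) (riskGradient ℓ ν w)
    have h2 := pow_le_pow_left₀ (norm_nonneg _) h1 2
    have h3 := hg z
    nlinarith [sq_nonneg (‖gradient (ℓ z) w‖ - ‖riskGradient ℓ ν w‖)]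
  have hs0 : 0 ≤ s := (sq_nonneg _).trans hGz
  -- This makes the variance term 4q²s‖G‖² at most the compensator q‖G‖²/2.
  have hqs : 8 * (q * s) ≤ 1 := by rw [hs]; linarith
  have hsq : ∀ z, (inner ℝ G (ξ z)) ^ 2 ≤ ‖G‖ ^ 2 * (4 * s) := fun z => by
    have h1 := pow_le_pow_left₀ (abs_nonneg _) (abs_real_inner_le_norm G (ξ z)) 2
    rw [sq_abs, mul_pow] at h1
    exact h1.trans (mul_le_mul_of_nonneg_left (hξs z) (sq_nonneg _))
  have hξm : Measurable ξ := (h.measurable_gradient w).sub_const _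
  have hXm : Measurable fun z => -(q * inner ℝ G (ξ z)) :=
    ((measurable_const.inner hξm).const_mul q).neg
  have hint0 : ∫ z, inner ℝ G (ξ z) ∂ν = 0 := by
    have hi : Integrable ξ ν := (h.integrable_gradient w).sub (integrable_const _)
    have e1 : ∫ z, inner ℝ G (ξ z) ∂ν = inner ℝ G (∫ z, ξ z ∂ν) :=
      integral_inner (𝕜 := ℝ) hi G
    have e2 : ∫ z, ξ z ∂ν = 0 := by
      rw [hξ, integral_sub (h.integrable_gradient w) (integrable_const _)]
      simp [riskGradient]
    rw [e1, e2, inner_zero_right]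
  have hmain := lintegral_exp_le_exp_integral_add (ν := ν)
    (X := fun z => -(q * inner ℝ G (ξ z))) (U := fun _ => q ^ 2 * (‖G‖ ^ 2 * (4 * s))) hXm
    (fun z => by
      rw [abs_neg, ← sq_le_one_iff_abs_le_one, mul_pow]
      have h1 := mul_le_mul_of_nonneg_left (hsq z) (sq_nonneg q)
      have h2 : ‖G‖ ^ 2 * (4 * s) ≤ s * (4 * s) := by gcongr
      have h3 := mul_le_mul_of_nonneg_left h2 (sq_nonneg q)
      have h4 : 0 ≤ q * s := by positivity
      nlinarith)
    (fun z => by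
      have := mul_le_mul_of_nonneg_left (hsq z) (sq_nonneg q)
      nlinarith) (integrable_const _)
  rw [integral_neg, integral_const_mul, hint0] at hmain
  simp only [mul_zero, neg_zero, zero_add, integral_const, probReal_univ, one_smul] at hmain
  have hG0 := sq_nonneg ‖G‖
  calc _ = ∫⁻ z, ENNReal.ofReal (Real.exp (-(q * (1 / 2 * ‖G‖ ^ 2))))
        * ENNReal.ofReal (Real.exp (-(q * inner ℝ G (ξ z)))) ∂ν := by
        refine lintegral_congr fun z => ?_
        rw [← ENNReal.ofReal_mul (Real.exp_pos _).le, ← Real.exp_add]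
        congr 2
        simp only [hξ]
        ring
    _ = ENNReal.ofReal (Real.exp (-(q * (1 / 2 * ‖G‖ ^ 2))))
        * ∫⁻ z, ENNReal.ofReal (Real.exp (-(q * inner ℝ G (ξ z)))) ∂ν :=
        lintegral_const_mul' _ _ ENNReal.ofReal_ne_top
    _ ≤ ENNReal.ofReal (Real.exp (-(q * (1 / 2 * ‖G‖ ^ 2))))
        * ENNReal.ofReal (Real.exp (q ^ 2 * (‖G‖ ^ 2 * (4 * s)))) := by gcongr
    _ = ENNReal.ofReal (Real.exp (-(q * (1 / 2 * ‖G‖ ^ 2)) + q ^ 2 * (‖G‖ ^ 2 * (4 * s)))) := by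
        rw [← ENNReal.ofReal_mul (Real.exp_pos _).le, ← Real.exp_add]
    _ ≤ 1 := by
        rw [← ENNReal.ofReal_one]
        refine ENNReal.ofReal_le_ofReal (Real.exp_le_one_iff.2 ?_)
        have := mul_le_mul_of_nonneg_left hqs (mul_nonneg hq hG0)
        nlinarith

/-- Descent of the risk at the auxiliary point. -/
theorem IsSmoothConvexLoss.risk_auxPoint_step_le (h : IsSmoothConvexLoss ℓ ν L)
    (hβ : β < 1) (hLK : 2 * (L : ℝ) ≤ K) {α : ℝ} (hα : 0 ≤ α)
    (u w g : Param d) :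
    risk ℓ ν (auxPoint β w (heavyBallStep α β u w g))
      ≤ risk ℓ ν (auxPoint β u w)
        + α / (1 - β) * (-inner ℝ (riskGradient ℓ ν (auxPoint β u w)) (g - riskGradient ℓ ν w)
          - 1 / 2 * ‖riskGradient ℓ ν (auxPoint β u w)‖ ^ 2)
        + α / (1 - β) * (1 / 2 * (K * (β / (1 - β))) ^ 2 * ‖w - u‖ ^ 2)
        + K / 2 * (α / (1 - β)) ^ 2 * ‖g‖ ^ 2 := by
  have hη : 0 ≤ α / (1 - β) := div_nonneg hα (by linarith)
  have h1 := h.hasQuadraticUpperBound_risk hLK (auxPoint β u w)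
    (auxPoint β w (heavyBallStep α β u w g))
  have h2 := h.norm_riskGradient_sub_le (auxPoint β u w) w
  rw [auxPoint_heavyBallStep hβ] at h1 ⊢
  rw [show auxPoint β u w - (α / (1 - β)) • g - auxPoint β u w = -((α / (1 - β)) • g) by abel,
    inner_neg_right, inner_smul_right, norm_neg, norm_smul, mul_pow, Real.norm_eq_abs,
    sq_abs] at h1
  have h3 : ‖riskGradient ℓ ν (auxPoint β u w) - riskGradient ℓ ν w‖
      ≤ K * (|β / (1 - β)| * ‖w - u‖) := by
    refine h2.trans ?_
    rw [show auxPoint β u w - w = (β / (1 - β)) • (w - u) by simp [auxPoint], norm_smul,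
      Real.norm_eq_abs]
    have : (L : ℝ) ≤ K := by linarith [L.coe_nonneg]
    gcongr
  have h4 := pow_le_pow_left₀ (norm_nonneg _) h3 2
  rw [norm_sub_sq_real, mul_pow, mul_pow, sq_abs] at h4
  rw [inner_sub_right]
  have h5 := sq_nonneg ‖riskGradient ℓ ν w‖
  -- Polarization of the two risk gradients, dropping the nonnegative square of the one at w.
  have h6 : 1 / 2 * ‖riskGradient ℓ ν (auxPoint β u w)‖ ^ 2
      - 1 / 2 * (K * (β / (1 - β))) ^ 2 * ‖w - u‖ ^ 2
      ≤ inner ℝ (riskGradient ℓ ν (auxPoint β u w)) (riskGradient ℓ ν w) := by nlinarith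
  have h7 := mul_le_mul_of_nonneg_left h6 hη
  linarith

end OneStep

/-! ### The iterates: adaptedness, supermartingales, weighted descent. -/

section Iterates

variable {𝒵 : Type u} {d : ℕ}

theorem shb_add_two (ℓ : 𝒵 → Param d → ℝ) (α : ℕ → ℝ) (β : ℝ) (w₀ : Param d) (ζ : ℕ → 𝒵)
    (n : ℕ) : shb ℓ α β w₀ ζ (n + 2) = heavyBallStep (α (n + 1)) β (shb ℓ α β w₀ ζ n)
      (shb ℓ α β w₀ ζ (n + 1)) (gradient (ℓ (ζ (n + 1))) (shb ℓ α β w₀ ζ (n + 1))) := by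
  rw [shb, heavyBallStep]

/-- The Lyapunov function along the iterates, at the pair `(w_n, w_{n+1})`. -/
noncomputable def shbLyapunov (ℓ : 𝒵 → Param d → ℝ) (α : ℕ → ℝ) (β : ℝ) (w₀ v : Param d)
    (ζ : ℕ → 𝒵) (n : ℕ) : ℝ :=
  lyapunov β v (shb ℓ α β w₀ ζ n) (shb ℓ α β w₀ ζ (n + 1))

/-- The accumulated suboptimality and kinetic energy of the iterates up to `w_n`. -/
noncomputable def shbEnergy [MeasurableSpace 𝒵] (ℓ : 𝒵 → Param d → ℝ) (ν : Measure 𝒵)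
    (α : ℕ → ℝ) (β : ℝ) (w₀ v : Param d) (ζ : ℕ → 𝒵) (n : ℕ) : ℝ :=
  ∑ s ∈ Finset.range n,
    (α (s + 1) / (1 - β) * (risk ℓ ν (shb ℓ α β w₀ ζ (s + 1)) - risk ℓ ν v)
      + ‖shb ℓ α β w₀ ζ (s + 1) - shb ℓ α β w₀ ζ s‖ ^ 2)

/-- The sum of the first `n` effective step sizes. -/
noncomputable def stepSum (α : ℕ → ℝ) (β : ℝ) (n : ℕ) : ℝ :=
  ∑ s ∈ Finset.range n, α (s + 1) / (1 - β)

open Classical in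
/-- One increment of the weighted gradient noise, switched off where the Lyapunov function
exceeds `B - 1`. -/
noncomputable def noiseTerm [MeasurableSpace 𝒵] (ℓ : 𝒵 → Param d → ℝ) (ν : Measure 𝒵)
    (β : ℝ) (v : Param d) (B : ℝ) (q : ℝ) (u w : Param d) (z : 𝒵) : ℝ :=
  if 1 + lyapunov β v u w ≤ B then
    q * (-inner ℝ (riskGradient ℓ ν (auxPoint β u w)) (gradient (ℓ z) w - riskGradient ℓ ν w)
      - 1 / 2 * ‖riskGradient ℓ ν (auxPoint β u w)‖ ^ 2)
  else 0

/-- The accumulated weighted gradient noise. -/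
noncomputable def shbNoise [MeasurableSpace 𝒵] (ℓ : 𝒵 → Param d → ℝ) (ν : Measure 𝒵)
    (α : ℕ → ℝ) (β : ℝ) (w₀ v : Param d) (B : ℝ) (ζ : ℕ → 𝒵) (n : ℕ) : ℝ :=
  ∑ s ∈ Finset.range n, noiseTerm ℓ ν β v B (stepSum α β (s + 1) * (α (s + 1) / (1 - β)))
    (shb ℓ α β w₀ ζ s) (shb ℓ α β w₀ ζ (s + 1)) (ζ (s + 1))

theorem measurable_auxPoint (β : ℝ) :
    Measurable fun q : Param d × Param d => auxPoint β q.1 q.2 := by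
  unfold auxPoint; fun_prop

theorem measurable_lyapunov (β : ℝ) (v : Param d) :
    Measurable fun q : Param d × Param d => lyapunov β v q.1 q.2 := by
  unfold lyapunov auxPoint; fun_prop

theorem shbLyapunov_zero (ℓ : 𝒵 → Param d → ℝ) (α : ℕ → ℝ) (β : ℝ) (w₀ v : Param d)
    (ζ : ℕ → 𝒵) : shbLyapunov ℓ α β w₀ v ζ 0 = ‖w₀ - v‖ ^ 2 := by
  simp [shbLyapunov, lyapunov, auxPoint, shb]

variable [MeasurableSpace 𝒵] {ℓ : 𝒵 → Param d → ℝ} {ν : Measure 𝒵} {L : ℝ≥0}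

theorem IsSmoothConvexLoss.measurable_heavyBallStep (h : IsSmoothConvexLoss ℓ ν L) (α β : ℝ) :
    Measurable fun q : (Param d × Param d) × 𝒵 =>
      heavyBallStep α β q.1.1 q.1.2 (gradient (ℓ q.2) q.1.2) := by
  have hg : Measurable fun q : (Param d × Param d) × 𝒵 => gradient (ℓ q.2) q.1.2 :=
    h.measurable_uncurry_gradient.comp (measurable_snd.prodMk measurable_fst.snd)
  unfold heavyBallStep
  fun_prop

theorem IsSmoothConvexLoss.measurable_noiseTerm [SFinite ν] (h : IsSmoothConvexLoss ℓ ν L)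
    (β : ℝ) (v : Param d) (B q : ℝ) :
    Measurable fun x : (Param d × Param d) × 𝒵 => noiseTerm ℓ ν β v B q x.1.1 x.1.2 x.2 := by
  have hg : Measurable fun x : (Param d × Param d) × 𝒵 => gradient (ℓ x.2) x.1.2 :=
    h.measurable_uncurry_gradient.comp (measurable_snd.prodMk measurable_fst.snd)
  have hG : Measurable fun x : (Param d × Param d) × 𝒵 =>
      riskGradient ℓ ν (auxPoint β x.1.1 x.1.2) :=
    h.measurable_riskGradient.comp ((measurable_auxPoint β).comp measurable_fst)
  have hw : Measurable fun x : (Param d × Param d) × 𝒵 => riskGradient ℓ ν x.1.2 :=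
    h.measurable_riskGradient.comp measurable_fst.snd
  refine Measurable.ite (measurableSet_le
    (((measurable_lyapunov β v).comp measurable_fst).const_add 1) measurable_const) ?_
    measurable_const
  exact (((hG.inner (hg.sub hw)).neg).sub ((hG.norm.pow_const 2).const_mul _)).const_mul q

variable {Ω : Type v} {Z : ℕ → Ω → 𝒵}

/-- The iterate w_{n+1} uses no sample of index above n, so the sample Z_{n+1} that drives the next
step is independent of it. -/
theorem IsSmoothConvexLoss.measurable_shb_strictPast (h : IsSmoothConvexLoss ℓ ν L)
    (α : ℕ → ℝ) (β : ℝ) (w₀ : Param d) (n : ℕ) :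
    Measurable[strictPast Z n] (fun ω => shb ℓ α β w₀ (fun t => Z t ω) n) ∧
    Measurable[strictPast Z (n + 1)] (fun ω => shb ℓ α β w₀ (fun t => Z t ω) (n + 1)) := by
  induction n with
  | zero => exact ⟨measurable_const, measurable_const⟩
  | succ n ih =>
    refine ⟨ih.2, ?_⟩
    simp_rw [shb_add_two]
    exact (h.measurable_heavyBallStep (α (n + 1)) β).comp
      (((ih.1.mono (strictPast_mono (by omega)) le_rfl).prodMk
        (ih.2.mono (strictPast_mono (by omega)) le_rfl)).prodMk
        (measurable_strictPast (by omega)))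

theorem IsSmoothConvexLoss.measurable_shb_pair (h : IsSmoothConvexLoss ℓ ν L)
    (α : ℕ → ℝ) (β : ℝ) (w₀ : Param d) {n m : ℕ} (hnm : n + 1 ≤ m) :
    Measurable[strictPast Z m] fun ω => (shb ℓ α β w₀ (fun t => Z t ω) n,
      shb ℓ α β w₀ (fun t => Z t ω) (n + 1)) :=
  have hp := h.measurable_shb_strictPast (Z := Z) α β w₀ n
  (hp.1.mono (strictPast_mono (by omega)) le_rfl).prodMk
    (hp.2.mono (strictPast_mono hnm) le_rfl)

theorem IsSmoothConvexLoss.measurable_shbLyapunov (h : IsSmoothConvexLoss ℓ ν L)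
    (α : ℕ → ℝ) (β : ℝ) (w₀ v : Param d) (n : ℕ) :
    Measurable[strictPast Z (n + 1)]
      fun ω => shbLyapunov ℓ α β w₀ v (fun t => Z t ω) n := by
  have hm := (measurable_lyapunov β v).comp
    (h.measurable_shb_pair (Z := Z) (n := n) α β w₀ le_rfl)
  simpa only [Function.comp_def, shbLyapunov] using hm

theorem IsSmoothConvexLoss.measurable_shbEnergy [SFinite ν] (h : IsSmoothConvexLoss ℓ ν L)
    (α : ℕ → ℝ) (β : ℝ) (w₀ v : Param d) (n : ℕ) :
    Measurable[strictPast Z (n + 1)]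
      fun ω => shbEnergy ℓ ν α β w₀ v (fun t => Z t ω) n := by
  have hm : ∀ s, Measurable fun q : Param d × Param d =>
      α (s + 1) / (1 - β) * (risk ℓ ν q.2 - risk ℓ ν v) + ‖q.2 - q.1‖ ^ 2 := fun s =>
    (((h.measurable_risk.comp measurable_snd).sub_const _).const_mul _).add
      ((measurable_snd.sub measurable_fst).norm.pow_const 2)
  simp only [shbEnergy]
  refine Finset.measurable_sum _ fun s hs => ?_
  have hs := Finset.mem_range.1 hs
  have := (hm s).comp (h.measurable_shb_pair (Z := Z) (n := s) (m := n + 1) α β w₀ (by omega))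
  simpa only [Function.comp_def] using this

theorem IsSmoothConvexLoss.measurable_shbNoise [SFinite ν] (h : IsSmoothConvexLoss ℓ ν L)
    (α : ℕ → ℝ) (β : ℝ) (w₀ v : Param d) (B : ℝ) (n : ℕ) :
    Measurable[strictPast Z (n + 1)]
      fun ω => shbNoise ℓ ν α β w₀ v B (fun t => Z t ω) n := by
  simp only [shbNoise]
  refine Finset.measurable_sum _ fun s hs => ?_
  have hs := Finset.mem_range.1 hs
  have := (h.measurable_noiseTerm β v B
    (stepSum α β (s + 1) * (α (s + 1) / (1 - β)))).comp
    ((h.measurable_shb_pair (Z := Z) (n := s) (m := n + 1) α β w₀ (by omega)).prodMk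
      (measurable_strictPast (Z := Z) (s := s + 1) (t := n + 1) (by omega)))
  simpa only [Function.comp_def] using this

variable {β K M : ℝ} {v : Param d} {α : ℕ → ℝ} {w₀ : Param d}

theorem shbEnergy_nonneg (hβ : β < 1) (hmin : ∀ w, risk ℓ ν v ≤ risk ℓ ν w)
    (hα : ∀ n, 0 ≤ α (n + 1)) (ζ : ℕ → 𝒵) (n : ℕ) : 0 ≤ shbEnergy ℓ ν α β w₀ v ζ n :=
  Finset.sum_nonneg fun s _ => add_nonneg (mul_nonneg (div_nonneg (hα s) (by linarith))
    (sub_nonneg.2 (hmin _))) (sq_nonneg _)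

theorem IsSmoothConvexLoss.shbLyapunov_le (h : IsSmoothConvexLoss ℓ ν L)
    (hβ₀ : 0 ≤ β) (hβ : β < 1) (hLK : 2 * (L : ℝ) ≤ K) (hK : 0 < K)
    (hv : ∀ z, ℓ z v ≤ M) (hα : ∀ n, 0 ≤ α (n + 1))
    (haα : ∀ n, curvConst β K * (α (n + 1) / (1 - β)) ≤ 1 / 4) (ζ : ℕ → 𝒵) (n : ℕ) :
    shbLyapunov ℓ α β w₀ v ζ n ≤ ‖w₀ - v‖ ^ 2 + 2 * M * stepSum α β n := by
  induction n with
  | zero => simp [shbLyapunov_zero, stepSum]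
  | succ n ih =>
    have h1 := h.lyapunov_step_le_add hβ₀ hβ hLK hK hv (hα n) (haα n) (ζ (n + 1))
      (shb ℓ α β w₀ ζ n) (shb ℓ α β w₀ ζ (n + 1))
    rw [← shb_add_two] at h1
    have h2 : stepSum α β (n + 1) = stepSum α β n + α (n + 1) / (1 - β) :=
      Finset.sum_range_succ _ _
    rw [h2]
    simp only [shbLyapunov] at ih ⊢
    linarith

variable [IsProbabilityMeasure ν] [MeasurableSpace Ω] {P : Measure Ω} [IsProbabilityMeasure P]

/-- Exponential moments of the Lyapunov function plus the accumulated energy, with a slowly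
decreasing exponent. -/
theorem IsSmoothConvexLoss.lintegral_exp_shbLyapunov_le (h : IsSmoothConvexLoss ℓ ν L)
    (hβ₀ : 0 ≤ β) (hβ : β < 1) (hLK : 2 * (L : ℝ) ≤ K) (hK : 0 < K) (hM : 0 ≤ M)
    (hv : ∀ z, ℓ z v ≤ M) (hmin : ∀ w, risk ℓ ν v ≤ risk ℓ ν w) (hα : ∀ n, 0 ≤ α (n + 1))
    (haα : ∀ n, curvConst β K * (α (n + 1) / (1 - β)) ≤ 1 / 4) {r : ℝ} (hr : 0 ≤ r)
    (hsmall : ∀ ζ n, 18 * r * (α (n + 1) / (1 - β)) * growthConst β K M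
      * (1 + shbLyapunov ℓ α β w₀ v ζ n) ≤ 1)
    (hZ : ∀ t, Measurable (Z t)) (hind : iIndepFun Z P) (hlaw : ∀ t, P.map (Z t) = ν) (n : ℕ) :
    ∫⁻ ω, ENNReal.ofReal (Real.exp (
      r * Real.exp (-((2 * curvConst β K * M + 12 * r * growthConst β K M * M)
          * ∑ s ∈ Finset.range n, (α (s + 1) / (1 - β)) ^ 2))
        * (1 + shbLyapunov ℓ α β w₀ v (fun t => Z t ω) n
          + shbEnergy ℓ ν α β w₀ v (fun t => Z t ω) n))) ∂P
      ≤ ENNReal.ofReal (Real.exp (r * (1 + ‖w₀ - v‖ ^ 2))) := by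
  have ha := curvConst_pos (β := β) hK
  have hkpos := growthConst_pos (β := β) hK hM
  set γ := 2 * curvConst β K * M + 12 * r * growthConst β K M * M with hγ
  have hγ0 : 0 ≤ γ := by positivity
  induction n with
  | zero => simp [shbLyapunov_zero, shbEnergy]
  | succ n ih =>
    refine le_trans ?_ ih
    set η := α (n + 1) / (1 - β) with hη
    have hη0 : 0 ≤ η := div_nonneg (hα n) (by linarith)
    set σ := ∑ s ∈ Finset.range n, (α (s + 1) / (1 - β)) ^ 2
    rw [Finset.sum_range_succ]
    set r' := r * Real.exp (-(γ * (σ + η ^ 2))) with hr'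
    have hr'0 : 0 ≤ r' := by positivity
    have hr'r : r' ≤ r := by
      refine mul_le_of_le_one_right hr (Real.exp_le_one_iff.2 ?_)
      have : 0 ≤ σ := Finset.sum_nonneg fun _ _ => sq_nonneg _
      have : 0 ≤ γ * (σ + η ^ 2) := by positivity
      linarith
    -- The one-step error is at most r'γη²(1 + V + J), proportional to the controlled quantity;
    -- shrinking the exponent by exp(-γη²) absorbs it.
    have hr'' : r' * (1 + γ * η ^ 2) ≤ r * Real.exp (-(γ * σ)) := by
      have h1 : 1 + γ * η ^ 2 ≤ Real.exp (γ * η ^ 2) := by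
        rw [add_comm]; exact Real.add_one_le_exp _
      refine (mul_le_mul_of_nonneg_left h1 hr'0).trans_eq ?_
      rw [hr', mul_assoc, ← Real.exp_add]
      congr 2
      ring
    have hφm : Measurable fun q : (Param d × Param d) × 𝒵 =>
        r' * (lyapunov β v q.1.2 (heavyBallStep (α (n + 1)) β q.1.1 q.1.2
          (gradient (ℓ q.2) q.1.2)) + ‖q.1.2 - q.1.1‖ ^ 2
          + η * (risk ℓ ν q.1.2 - risk ℓ ν v) - lyapunov β v q.1.1 q.1.2) := by
      have m1 : Measurable fun q : (Param d × Param d) × 𝒵 => lyapunov β v q.1.1 q.1.2 :=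
        (measurable_lyapunov β v).comp measurable_fst
      have m2 := (measurable_lyapunov β v).comp ((measurable_fst.snd).prodMk
        (h.measurable_heavyBallStep (α (n + 1)) β))
      have m3 : Measurable fun q : (Param d × Param d) × 𝒵 => risk ℓ ν q.1.2 :=
        h.measurable_risk.comp measurable_fst.snd
      simp only [Function.comp_def] at m2
      exact (((m2.add ((measurable_fst.snd.sub measurable_fst.fst).norm.pow_const 2)).add
        ((m3.sub_const _).const_mul _)).sub m1).const_mul _
    have hJm : Measurable[strictPast Z (n + 1)] fun ω =>
        r' * (1 + shbLyapunov ℓ α β w₀ v (fun t => Z t ω) n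
          + shbEnergy ℓ ν α β w₀ v (fun t => Z t ω) n) :=
      (((h.measurable_shbLyapunov (Z := Z) α β w₀ v n).const_add 1).add
        (h.measurable_shbEnergy (Z := Z) α β w₀ v n)).const_mul r'
    have hstep : ∀ ζ : ℕ → 𝒵, r' * (1 + shbLyapunov ℓ α β w₀ v ζ (n + 1)
          + shbEnergy ℓ ν α β w₀ v ζ (n + 1))
        = r' * (1 + shbLyapunov ℓ α β w₀ v ζ n + shbEnergy ℓ ν α β w₀ v ζ n)
          + r' * (lyapunov β v (shb ℓ α β w₀ ζ (n + 1)) (heavyBallStep (α (n + 1)) β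
            (shb ℓ α β w₀ ζ n) (shb ℓ α β w₀ ζ (n + 1))
            (gradient (ℓ (ζ (n + 1))) (shb ℓ α β w₀ ζ (n + 1))))
            + ‖shb ℓ α β w₀ ζ (n + 1) - shb ℓ α β w₀ ζ n‖ ^ 2
          + η * (risk ℓ ν (shb ℓ α β w₀ ζ (n + 1)) - risk ℓ ν v)
          - lyapunov β v (shb ℓ α β w₀ ζ n) (shb ℓ α β w₀ ζ (n + 1))) := fun ζ => by
      rw [← shb_add_two]
      simp only [shbEnergy, shbLyapunov, Finset.sum_range_succ]
      ring
    simp only [hstep]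
    have hsmall' : ∀ ζ : ℕ → 𝒵, 18 * r' * η * growthConst β K M
        * (1 + lyapunov β v (shb ℓ α β w₀ ζ n) (shb ℓ α β w₀ ζ (n + 1))) ≤ 1 := fun ζ => by
      have hs := hsmall ζ n
      have hV0 := lyapunov_nonneg hβ v (shb ℓ α β w₀ ζ n) (shb ℓ α β w₀ ζ (n + 1))
      simp only [shbLyapunov] at hs
      have hkV : 0 ≤ η * growthConst β K M
        * (1 + lyapunov β v (shb ℓ α β w₀ ζ n) (shb ℓ α β w₀ ζ (n + 1))) := by positivity
      nlinarith [mul_le_mul_of_nonneg_right hr'r hkV]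
    refine (lintegral_exp_add_strictPast_le hZ hind hlaw
      (h.measurable_shb_pair (Z := Z) (n := n) α β w₀ le_rfl) hJm hφm
      (fun ω => h.lintegral_exp_lyapunov_step_le (v := v) hβ₀ hβ hLK hK hM hv hmin (hα n)
        (haα n) hr'0 _ _ (hsmall' fun t => Z t ω))).trans ?_
    refine lintegral_mono fun ω => ENNReal.ofReal_le_ofReal (Real.exp_le_exp.2 ?_)
    have hV0 := lyapunov_nonneg hβ v (shb ℓ α β w₀ (fun t => Z t ω) n)
      (shb ℓ α β w₀ (fun t => Z t ω) (n + 1))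
    have hJ0 := shbEnergy_nonneg (w₀ := w₀) hβ hmin hα (fun t => Z t ω) n
    simp only [shbLyapunov]
    set V := lyapunov β v (shb ℓ α β w₀ (fun t => Z t ω) n)
      (shb ℓ α β w₀ (fun t => Z t ω) (n + 1))
    set J := shbEnergy ℓ ν α β w₀ v (fun t => Z t ω) n
    have h1 : 2 * curvConst β K * M + 12 * r' * growthConst β K M * M * (1 + V)
        ≤ γ * (1 + V + J) := by
      have e1 : 0 ≤ growthConst β K M * M * (1 + V) := by positivity
      have e2 := mul_le_mul_of_nonneg_right hr'r e1
      have e3 : 0 ≤ 2 * curvConst β K * M * V := by positivity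
      have e4 : 0 ≤ γ * J := by positivity
      rw [hγ] at e4 ⊢
      nlinarith
    have h2 := mul_le_mul_of_nonneg_left h1 (mul_nonneg hr'0 (sq_nonneg η))
    have h3 := mul_le_mul_of_nonneg_right hr'' (by positivity : 0 ≤ 1 + V + J)
    nlinarith

/-- The exponential of the compensated, truncated gradient noise is a supermartingale. -/
theorem IsSmoothConvexLoss.lintegral_exp_shbNoise_le_one (h : IsSmoothConvexLoss ℓ ν L)
    (hβ₀ : 0 ≤ β) (hβ : β < 1) (hLK : 2 * (L : ℝ) ≤ K) (hK : 0 < K) (hM : 0 ≤ M)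
    (hv : ∀ z, ℓ z v ≤ M) (hα : ∀ n, 0 ≤ α (n + 1)) {r B : ℝ} (hr : 0 ≤ r)
    (hsmall : ∀ n, 16 * (r * (stepSum α β (n + 1) * (α (n + 1) / (1 - β)))) * K
      * growthConst β K M * B ≤ 1)
    (hZ : ∀ t, Measurable (Z t)) (hind : iIndepFun Z P) (hlaw : ∀ t, P.map (Z t) = ν) (n : ℕ) :
    ∫⁻ ω, ENNReal.ofReal (Real.exp (
      r * shbNoise ℓ ν α β w₀ v B (fun t => Z t ω) n)) ∂P ≤ 1 := by
  induction n with
  | zero => simp [shbNoise]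
  | succ n ih =>
    refine le_trans ?_ ih
    set q := stepSum α β (n + 1) * (α (n + 1) / (1 - β)) with hq
    have hq0 : 0 ≤ q := mul_nonneg
      (Finset.sum_nonneg fun s _ => div_nonneg (hα s) (by linarith))
      (div_nonneg (hα n) (by linarith))
    have hstep : ∀ ζ : ℕ → 𝒵, r * shbNoise ℓ ν α β w₀ v B ζ (n + 1)
        = r * shbNoise ℓ ν α β w₀ v B ζ n + r * noiseTerm ℓ ν β v B q
          (shb ℓ α β w₀ ζ n) (shb ℓ α β w₀ ζ (n + 1)) (ζ (n + 1)) := fun ζ => by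
      simp only [shbNoise, Finset.sum_range_succ]
      ring
    simp only [hstep]
    refine (lintegral_exp_add_strictPast_le hZ hind hlaw
      (h.measurable_shb_pair (Z := Z) (n := n) α β w₀ le_rfl)
      ((h.measurable_shbNoise (Z := Z) α β w₀ v B n).const_mul r)
      ((h.measurable_noiseTerm β v B q).const_mul r) (b := fun _ => 0) (fun ω => ?_)).trans ?_
    · rw [Real.exp_zero, ENNReal.ofReal_one]
      by_cases hB : 1 + lyapunov β v (shb ℓ α β w₀ (fun t => Z t ω) n)
        (shb ℓ α β w₀ (fun t => Z t ω) (n + 1)) ≤ B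
      · have := h.lintegral_exp_noise_le_one hβ₀ hβ hLK hK hM hv (mul_nonneg hr hq0) _ _ hB
          (hsmall n)
        simpa only [noiseTerm, if_pos hB, mul_assoc] using this
      · simp [noiseTerm, if_neg hB]
    · simp only [add_zero]
      exact le_rfl

/-- On the event where the Lyapunov function stays below `B - 1`, the weighted suboptimality of
the last iterate is controlled by the accumulated noise and energy. -/
theorem IsSmoothConvexLoss.stepSum_mul_le (h : IsSmoothConvexLoss ℓ ν L)
    (hβ₀ : 0 ≤ β) (hβ : β < 1) (hLK : 2 * (L : ℝ) ≤ K) (hK : 0 < K) (hM : 0 ≤ M)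
    (hv : ∀ z, ℓ z v ≤ M) (hmin : ∀ w, risk ℓ ν v ≤ risk ℓ ν w) (hα : ∀ n, 0 ≤ α (n + 1))
    {B E a : ℝ} (hE : ∀ n, stepSum α β (n + 1) * (α (n + 1) / (1 - β)) ≤ E)
    (ha : ∀ n, α (n + 1) / (1 - β) ≤ a) (ζ : ℕ → 𝒵) {n : ℕ}
    (hB : ∀ s < n, 1 + shbLyapunov ℓ α β w₀ v ζ s ≤ B) :
    stepSum α β n * (risk ℓ ν (auxPoint β (shb ℓ α β w₀ ζ n) (shb ℓ α β w₀ ζ (n + 1)))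
        - risk ℓ ν v + ‖shb ℓ α β w₀ ζ (n + 1) - shb ℓ α β w₀ ζ n‖ ^ 2)
      ≤ shbNoise ℓ ν α β w₀ v B ζ n
        + (2 + a + a * (K * (β / (1 - β)) ^ 2) + E * (1 / 2 * (K * (β / (1 - β))) ^ 2))
          * shbEnergy ℓ ν α β w₀ v ζ n
        + (K / 2 + 1) * (2 * K * growthConst β K M * B)
          * ∑ s ∈ Finset.range n, stepSum α β (s + 1) * (α (s + 1) / (1 - β)) ^ 2 := by
  have hb : 0 < 1 - β := by linarith
  have hkpos := growthConst_pos (β := β) hK hM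
  induction n with
  | zero => simp [stepSum, shbNoise, shbEnergy]
  | succ n ih =>
    have ih := ih fun s hs => hB s (by omega)
    have hBn := hB n (by omega)
    have hg := h.norm_gradient_sq_le_growth hβ₀ hβ hLK hK hM hv (ζ (n + 1))
      (shb ℓ α β w₀ ζ n) (shb ℓ α β w₀ ζ (n + 1))
    have hdesc := h.risk_auxPoint_step_le hβ hLK (hα n) (shb ℓ α β w₀ ζ n)
      (shb ℓ α β w₀ ζ (n + 1)) (gradient (ℓ (ζ (n + 1))) (shb ℓ α β w₀ ζ (n + 1)))
    have hkin := norm_sq_heavyBallStep_sub_le hβ₀ hβ (α (n + 1)) (shb ℓ α β w₀ ζ n)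
      (shb ℓ α β w₀ ζ (n + 1)) (gradient (ℓ (ζ (n + 1))) (shb ℓ α β w₀ ζ (n + 1)))
    have hcmp := (h.hasQuadraticUpperBound_risk hLK).sub_le_two_mul hK hmin
      (shb ℓ α β w₀ ζ (n + 1)) (auxPoint β (shb ℓ α β w₀ ζ n) (shb ℓ α β w₀ ζ (n + 1)))
    rw [show auxPoint β (shb ℓ α β w₀ ζ n) (shb ℓ α β w₀ ζ (n + 1)) - shb ℓ α β w₀ ζ (n + 1)
      = (β / (1 - β)) • (shb ℓ α β w₀ ζ (n + 1) - shb ℓ α β w₀ ζ n) by simp [auxPoint],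
      norm_smul, mul_pow, Real.norm_eq_abs, sq_abs] at hcmp
    rw [← shb_add_two] at hdesc hkin
    have hEn := hE n
    have han := ha n
    have hQ : stepSum α β (n + 1) = stepSum α β n + α (n + 1) / (1 - β) :=
      Finset.sum_range_succ _ _
    have hQ0 : 0 ≤ stepSum α β (n + 1) :=
      Finset.sum_nonneg fun s _ => div_nonneg (hα s) hb.le
    have hη0 : 0 ≤ α (n + 1) / (1 - β) := div_nonneg (hα n) hb.le
    have hD0 := sub_nonneg.2 (hmin (shb ℓ α β w₀ ζ (n + 1)))
    unfold shbNoise shbEnergy at ih ⊢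
    rw [Finset.sum_range_succ, Finset.sum_range_succ, Finset.sum_range_succ]
    simp only [noiseTerm] at ih ⊢
    simp only [shbLyapunov] at hBn
    rw [if_pos hBn]
    have hgB := hg.trans (mul_le_mul_of_nonneg_left hBn
      (by positivity : 0 ≤ 2 * K * growthConst β K M))
    set Y := -inner ℝ (riskGradient ℓ ν (auxPoint β (shb ℓ α β w₀ ζ n)
        (shb ℓ α β w₀ ζ (n + 1)))) (gradient (ℓ (ζ (n + 1))) (shb ℓ α β w₀ ζ (n + 1))
          - riskGradient ℓ ν (shb ℓ α β w₀ ζ (n + 1)))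
      - 1 / 2 * ‖riskGradient ℓ ν (auxPoint β (shb ℓ α β w₀ ζ n) (shb ℓ α β w₀ ζ (n + 1)))‖ ^ 2
    set G := ‖gradient (ℓ (ζ (n + 1))) (shb ℓ α β w₀ ζ (n + 1))‖ ^ 2
    set m := ‖shb ℓ α β w₀ ζ (n + 1) - shb ℓ α β w₀ ζ n‖ ^ 2 with hm
    have hm0 : 0 ≤ m := sq_nonneg _
    have hG0 : 0 ≤ G := sq_nonneg _
    set D := risk ℓ ν (shb ℓ α β w₀ ζ (n + 1)) - risk ℓ ν v
    set A := risk ℓ ν (auxPoint β (shb ℓ α β w₀ ζ n) (shb ℓ α β w₀ ζ (n + 1)))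
    set A' := risk ℓ ν (auxPoint β (shb ℓ α β w₀ ζ (n + 1)) (shb ℓ α β w₀ ζ (n + 2)))
    set m' := ‖shb ℓ α β w₀ ζ (n + 2) - shb ℓ α β w₀ ζ (n + 1)‖ ^ 2
    set F := risk ℓ ν v
    set η := α (n + 1) / (1 - β)
    set Q' := stepSum α β (n + 1)
    set Q := stepSum α β n
    set g := 2 * K * growthConst β K M * B
    set c := β / (1 - β)
    have hkin' : m' ≤ m + η ^ 2 * G := by
      have e1 : β * m ≤ m := mul_le_of_le_one_left hm0 hβ.le
      have e2 : (1 - β) * η ^ 2 * G ≤ η ^ 2 * G := by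
        have : 0 ≤ η ^ 2 * G := by positivity
        nlinarith
      linarith
    have e1 := mul_le_mul_of_nonneg_left (add_le_add hdesc hkin') hQ0
    have e2 := mul_le_mul_of_nonneg_left hcmp hη0
    have e3 : η * m ≤ a * m := mul_le_mul_of_nonneg_right han hm0
    have e4 : η * (K * (c ^ 2 * m)) ≤ a * (K * (c ^ 2 * m)) :=
      mul_le_mul_of_nonneg_right han (by positivity)
    have e5 : Q' * η * (1 / 2 * (K * c) ^ 2 * m) ≤ E * (1 / 2 * (K * c) ^ 2 * m) :=
      mul_le_mul_of_nonneg_right hEn (by positivity)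
    have e6 : Q' * η ^ 2 * ((K / 2 + 1) * G) ≤ Q' * η ^ 2 * ((K / 2 + 1) * g) := by
      gcongr
    have ha0 : 0 ≤ a := hη0.trans han
    have hE0 : 0 ≤ E := (mul_nonneg hQ0 hη0).trans hEn
    have e7 : 0 ≤ (a + a * (K * c ^ 2) + E * (1 / 2 * (K * c) ^ 2)) * (η * D) := by positivity
    have e8 : 0 ≤ m := hm0
    -- Raising the weight from Q to Q' costs η(A - F + m); `e2`, `e3` and `e4` charge this to the
    -- energy increment ηD + m.
    have e9 : Q' * (A - F + m) = Q * (A - F + m) + η * (A - F) + η * m := by rw [hQ]; ring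
    linarith

end Iterates

/-! ### Sums of powers and of step sizes. -/

section PowerSums

/-- Bernoulli's inequality for the exponent 1-p bounds each term by a telescoping difference. -/
theorem sum_range_rpow_neg_le {p : ℝ} (hp₀ : 0 < p) (hp : p < 1) (n : ℕ) :
    ∑ s ∈ Finset.range n, ((s + 1 : ℕ) : ℝ) ^ (-p) ≤ (n : ℝ) ^ (1 - p) / (1 - p) := by
  have h1p : 0 < 1 - p := by linarith
  induction n with
  | zero => simp [Real.zero_rpow h1p.ne']
  | succ n ih =>
    rw [Finset.sum_range_succ]
    have hn : (0 : ℝ) < ((n + 1 : ℕ) : ℝ) := by positivity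
    have hbern := rpow_one_add_le_one_add_mul_self (s := -(1 / ((n + 1 : ℕ) : ℝ)))
      (p := 1 - p) (by
        rw [neg_le_neg_iff, div_le_one hn]
        push_cast
        linarith [(Nat.cast_nonneg n : (0 : ℝ) ≤ n)]) h1p.le (by linarith)
    have hfac : (n : ℝ) = ((n + 1 : ℕ) : ℝ) * (1 + -(1 / ((n + 1 : ℕ) : ℝ))) := by
      field_simp
      push_cast
      ring
    have hle : (n : ℝ) ^ (1 - p)
        ≤ ((n + 1 : ℕ) : ℝ) ^ (1 - p) - (1 - p) * ((n + 1 : ℕ) : ℝ) ^ (-p) := by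
      have hb0 : 0 ≤ 1 + -(1 / ((n + 1 : ℕ) : ℝ)) := by
        have : 1 / ((n + 1 : ℕ) : ℝ) ≤ 1 := by
          rw [div_le_one hn]
          push_cast
          linarith [(Nat.cast_nonneg n : (0 : ℝ) ≤ n)]
        linarith
      have e : ((n + 1 : ℕ) : ℝ) ^ (-p)
          = ((n + 1 : ℕ) : ℝ) ^ (1 - p) * (1 / ((n + 1 : ℕ) : ℝ)) := by
        rw [show -p = (1 - p) - 1 by ring, Real.rpow_sub_one hn.ne']
        ring
      calc (n : ℝ) ^ (1 - p)
          = ((n + 1 : ℕ) : ℝ) ^ (1 - p) * (1 + -(1 / ((n + 1 : ℕ) : ℝ))) ^ (1 - p) := by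
            conv_lhs => rw [hfac]
            exact Real.mul_rpow hn.le hb0
        _ ≤ ((n + 1 : ℕ) : ℝ) ^ (1 - p) * (1 + (1 - p) * -(1 / ((n + 1 : ℕ) : ℝ))) := by
            gcongr
        _ = _ := by rw [e]; ring
    rw [le_div_iff₀ h1p] at ih ⊢
    nlinarith

/-- Comparison with the harmonic sum. The logarithm lets one bound cover x = -1, that is p = 2/3 in
`sum_stepSum_mul_sq_le`. -/
theorem sum_range_rpow_le_mul_log {x y : ℝ} (hxy : x + 1 ≤ y) (hy : 0 ≤ y) (n : ℕ) :
    ∑ s ∈ Finset.range n, ((s + 1 : ℕ) : ℝ) ^ x ≤ (n : ℝ) ^ y * (1 + Real.log n) := by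
  have hterm : ∀ s ∈ Finset.range n, ((s + 1 : ℕ) : ℝ) ^ x
      ≤ (n : ℝ) ^ y * ((s + 1 : ℕ) : ℝ)⁻¹ := fun s hs => by
    have hs := Finset.mem_range.1 hs
    have h0 : (0 : ℝ) < ((s + 1 : ℕ) : ℝ) := by positivity
    have h1 : (1 : ℝ) ≤ ((s + 1 : ℕ) : ℝ) := by exact_mod_cast Nat.succ_pos s
    have h2 : ((s + 1 : ℕ) : ℝ) ≤ n := by exact_mod_cast hs
    calc ((s + 1 : ℕ) : ℝ) ^ x ≤ ((s + 1 : ℕ) : ℝ) ^ (y - 1) :=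
          Real.rpow_le_rpow_of_exponent_le h1 (by linarith)
      _ = ((s + 1 : ℕ) : ℝ) ^ y * ((s + 1 : ℕ) : ℝ)⁻¹ := by
          rw [Real.rpow_sub_one h0.ne', div_eq_mul_inv]
      _ ≤ _ := by gcongr
  refine (Finset.sum_le_sum hterm).trans ?_
  rw [← Finset.mul_sum]
  refine mul_le_mul_of_nonneg_left ?_ (by positivity)
  have := harmonic_le_one_add_log n
  rw [harmonic] at this
  push_cast at this ⊢
  exact this

theorem exists_sum_range_rpow_le {p : ℝ} (hp : 1 / 2 < p) :
    ∃ S : ℝ, ∀ n : ℕ, ∑ s ∈ Finset.range n, (((s + 1 : ℕ) : ℝ) ^ (-p)) ^ 2 ≤ S := by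
  have hs : Summable fun s : ℕ => (((s + 1 : ℕ) : ℝ) ^ (-p)) ^ 2 := by
    have h1 : Summable fun n : ℕ => (n : ℝ) ^ (-p * 2) :=
      Real.summable_nat_rpow.2 (by linarith)
    refine ((summable_nat_add_iff 1).2 h1).congr fun s => ?_
    rw [Real.rpow_mul (by positivity), Real.rpow_two]
  exact ⟨∑' s : ℕ, (((s + 1 : ℕ) : ℝ) ^ (-p)) ^ 2, fun n => hs.sum_le_tsum _
    fun _ _ => by positivity⟩

variable {α : ℕ → ℝ} {β p e : ℝ}

theorem stepSum_le (hp₀ : 0 < p) (hp : p < 1) (he : 0 ≤ e)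
    (hη : ∀ n : ℕ, α (n + 1) / (1 - β) ≤ e * ((n + 1 : ℕ) : ℝ) ^ (-p)) (n : ℕ) :
    stepSum α β n ≤ e / (1 - p) * (n : ℝ) ^ (1 - p) := by
  have h1 := mul_le_mul_of_nonneg_left (sum_range_rpow_neg_le hp₀ hp n) he
  rw [Finset.mul_sum] at h1
  refine (Finset.sum_le_sum fun s _ => hη s).trans (h1.trans_eq ?_)
  ring

theorem stepSum_mul_step_le (hp₀ : 1 / 2 < p) (hp : p < 1) (he : 0 ≤ e)
    (hη₀ : ∀ n : ℕ, 0 ≤ α (n + 1) / (1 - β))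
    (hη : ∀ n : ℕ, α (n + 1) / (1 - β) ≤ e * ((n + 1 : ℕ) : ℝ) ^ (-p)) (n : ℕ) :
    stepSum α β (n + 1) * (α (n + 1) / (1 - β)) ≤ e ^ 2 / (1 - p) := by
  have h1p : 0 < 1 - p := by linarith
  have hn : (0 : ℝ) < ((n + 1 : ℕ) : ℝ) := by positivity
  calc _ ≤ (e / (1 - p) * ((n + 1 : ℕ) : ℝ) ^ (1 - p)) * (e * ((n + 1 : ℕ) : ℝ) ^ (-p)) :=
        mul_le_mul (stepSum_le (by linarith) hp he hη (n + 1)) (hη n) (hη₀ n) (by positivity)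
    _ = e ^ 2 / (1 - p) * ((n + 1 : ℕ) : ℝ) ^ (1 - p + -p) := by
        rw [Real.rpow_add hn]; ring
    _ ≤ e ^ 2 / (1 - p) * 1 := by
        gcongr
        exact Real.rpow_le_one_of_one_le_of_nonpos (by exact_mod_cast Nat.succ_pos n)
          (by linarith)
    _ = _ := mul_one _

theorem sum_stepSum_mul_sq_le (hp₀ : 0 < p) (hp : p < 1) (he : 0 ≤ e)
    (hη₀ : ∀ n : ℕ, 0 ≤ α (n + 1) / (1 - β))
    (hη : ∀ n : ℕ, α (n + 1) / (1 - β) ≤ e * ((n + 1 : ℕ) : ℝ) ^ (-p)) (n : ℕ) :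
    ∑ s ∈ Finset.range n, stepSum α β (s + 1) * (α (s + 1) / (1 - β)) ^ 2
      ≤ e ^ 3 / (1 - p) * ((n : ℝ) ^ (max 0 (2 - 3 * p)) * (1 + Real.log n)) := by
  have h1p : 0 < 1 - p := by linarith
  have h1 := mul_le_mul_of_nonneg_left (sum_range_rpow_le_mul_log (x := 1 - 3 * p)
    (y := max 0 (2 - 3 * p)) (by linarith [le_max_right 0 (2 - 3 * p)]) (le_max_left _ _) n)
    (by positivity : 0 ≤ e ^ 3 / (1 - p))
  refine le_trans ?_ h1
  rw [Finset.mul_sum]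
  refine Finset.sum_le_sum fun s _ => ?_
  have hs : (0 : ℝ) < ((s + 1 : ℕ) : ℝ) := by positivity
  calc _ ≤ (e / (1 - p) * ((s + 1 : ℕ) : ℝ) ^ (1 - p)) * (e * ((s + 1 : ℕ) : ℝ) ^ (-p)) ^ 2 :=
        mul_le_mul (stepSum_le hp₀ hp he hη (s + 1)) (pow_le_pow_left₀ (hη₀ s) (hη s) 2)
          (sq_nonneg _) (by positivity)
    _ = e ^ 3 / (1 - p) * ((s + 1 : ℕ) : ℝ) ^ (1 - p + -p + -p) := by
        rw [Real.rpow_add hs, Real.rpow_add hs]; ring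
    _ = _ := by ring_nf

theorem le_stepSum {c : ℝ} (hp₀ : 0 ≤ p) (hc : 0 ≤ c)
    (hη : ∀ n : ℕ, c * ((n + 1 : ℕ) : ℝ) ^ (-p) ≤ α (n + 1) / (1 - β)) {n : ℕ} (hn : 0 < n) :
    c * (n : ℝ) ^ (1 - p) ≤ stepSum α β n := by
  have hn' : (0 : ℝ) < n := by exact_mod_cast hn
  have h1 : ∀ s ∈ Finset.range n, c * (n : ℝ) ^ (-p) ≤ α (s + 1) / (1 - β) := fun s hs => by
    refine le_trans ?_ (hη s)
    have : ((s + 1 : ℕ) : ℝ) ≤ n := by exact_mod_cast Finset.mem_range.1 hs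
    exact mul_le_mul_of_nonneg_left
      (Real.rpow_le_rpow_of_nonpos (by positivity) this (by linarith)) hc
  have h2 := Finset.card_nsmul_le_sum _ _ _ h1
  rw [Finset.card_range, nsmul_eq_mul] at h2
  refine le_trans (le_of_eq ?_) h2
  rw [show 1 - p = 1 + -p by ring, Real.rpow_add hn', Real.rpow_one]
  ring

end PowerSums

/-! ### Tail of the Lyapunov function. -/

section HighProbability

variable {𝒵 : Type u} {d : ℕ} [MeasurableSpace 𝒵] {ℓ : 𝒵 → Param d → ℝ} {ν : Measure 𝒵}
  {L : ℝ≥0} {Ω : Type v} {Z : ℕ → Ω → 𝒵} {β K M : ℝ} {v : Param d} {α : ℕ → ℝ} {w₀ : Param d}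
  [IsProbabilityMeasure ν] [MeasurableSpace Ω] {P : Measure Ω} [IsProbabilityMeasure P]

/-- Tail bound for the Lyapunov function plus the accumulated energy. -/
theorem IsSmoothConvexLoss.measure_lt_shbLyapunov_le (h : IsSmoothConvexLoss ℓ ν L)
    (hβ₀ : 0 ≤ β) (hβ : β < 1) (hLK : 2 * (L : ℝ) ≤ K) (hK : 0 < K) (hM : 0 ≤ M)
    (hv : ∀ z, ℓ z v ≤ M) (hmin : ∀ w, risk ℓ ν v ≤ risk ℓ ν w) (hα : ∀ n, 0 ≤ α (n + 1))
    (haα : ∀ n, curvConst β K * (α (n + 1) / (1 - β)) ≤ 1 / 4) {r S R B : ℝ} (hr : 0 ≤ r)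
    (hsmall : ∀ ζ n, 18 * r * (α (n + 1) / (1 - β)) * growthConst β K M
      * (1 + shbLyapunov ℓ α β w₀ v ζ n) ≤ 1)
    (hS : ∀ n, ∑ s ∈ Finset.range n, (α (s + 1) / (1 - β)) ^ 2 ≤ S)
    (hR : ‖w₀ - v‖ ^ 2 ≤ R) (hB : 0 ≤ B)
    (hZ : ∀ t, Measurable (Z t)) (hind : iIndepFun Z P) (hlaw : ∀ t, P.map (Z t) = ν) (n : ℕ) :
    P {ω | B < 1 + shbLyapunov ℓ α β w₀ v (fun t => Z t ω) n
        + shbEnergy ℓ ν α β w₀ v (fun t => Z t ω) n}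
      ≤ ENNReal.ofReal (Real.exp (r * (1 + R)
        - r * Real.exp (-((2 * curvConst β K * M + 12 * r * growthConst β K M * M) * S)) * B)) := by
  rcases hr.eq_or_lt with rfl | hr
  · simpa using prob_le_one
  have hmain := h.lintegral_exp_shbLyapunov_le hβ₀ hβ hLK hK hM hv hmin hα haα hr.le hsmall hZ
    hind hlaw n
  have ha := curvConst_pos (β := β) hK
  have hkpos := growthConst_pos (β := β) hK hM
  set γ := 2 * curvConst β K * M + 12 * r * growthConst β K M * M
  have hγ0 : 0 ≤ γ := by positivity
  set σ := ∑ s ∈ Finset.range n, (α (s + 1) / (1 - β)) ^ 2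
  have hexp : r * Real.exp (-(γ * S)) ≤ r * Real.exp (-(γ * σ)) := by
    have := mul_le_mul_of_nonneg_left (hS n) hγ0
    gcongr
  have hJm : Measurable[strictPast Z (n + 1)] fun ω => r * Real.exp (-(γ * σ))
      * (1 + shbLyapunov ℓ α β w₀ v (fun t => Z t ω) n
        + shbEnergy ℓ ν α β w₀ v (fun t => Z t ω) n) :=
    (((h.measurable_shbLyapunov (Z := Z) α β w₀ v n).const_add 1).add
      (h.measurable_shbEnergy (Z := Z) α β w₀ v n)).const_mul _
  have hle := measure_lt_le_of_lintegral_exp_le (P := P)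
    (hJm.mono (strictPast_le hZ (n + 1)) le_rfl) (x := r * Real.exp (-(γ * S)) * B) hmain
  refine (measure_mono fun ω hω => ?_).trans (hle.trans
    (ENNReal.ofReal_le_ofReal (Real.exp_le_exp.2 ?_)))
  · rw [Set.mem_ofPred_eq] at hω ⊢
    exact (mul_le_mul_of_nonneg_right hexp hB).trans_lt
      (mul_lt_mul_of_pos_left hω (by positivity))
  · have := mul_le_mul_of_nonneg_left hR hr.le
    linarith

end HighProbability

/-! ### Choice of constants and conclusion. -/

section Main

set_option maxHeartbeats 1000000 in
/-- High-probability rate of the last stochastic heavy ball iterate, with `c₂ > 0` and `M ≥ 0`. -/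
theorem exists_shb_rate (L : ℝ≥0) {β : ℝ} (hβ₀ : 0 ≤ β) (hβ₁ : β < 1) {p c₁ c₂ M R : ℝ}
    (hp₀ : 1 / 2 < p) (hp : p < 1) (hc₁ : 0 < c₁) (hc₂ : 0 < c₂) (hM : 0 ≤ M) :
    ∃ C : ℝ, 0 < C ∧
    ∀ (d : ℕ) (𝒵 : Type u) [MeasurableSpace 𝒵] (ν : Measure 𝒵) [IsProbabilityMeasure ν]
      (ℓ : 𝒵 → Param d → ℝ), IsSmoothConvexLoss ℓ ν L →
    ∀ v : Param d, risk ℓ ν v = optRisk ℓ ν → (∀ z, ℓ z v ≤ M) →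
    ∀ w₀ : Param d, ‖w₀ - v‖ ≤ R →
    ∀ α : ℕ → ℝ,
      (∀ n, curvConst β (2 * ((L : ℝ) + 1)) * (α (n + 1) / (1 - β)) ≤ 1 / 4) →
      (∀ t : ℕ, 1 ≤ t → c₁ * (t : ℝ) ^ (-p) ≤ α t ∧ α t ≤ c₂ * (t : ℝ) ^ (-p)) →
    ∀ (Ω : Type v) [MeasurableSpace Ω] (P : Measure Ω) [IsProbabilityMeasure P]
      (Z : ℕ → Ω → 𝒵), (∀ t, Measurable (Z t)) → iIndepFun Z P → (∀ t, P.map (Z t) = ν) →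
    ∀ T : ℕ, 2 ≤ T → ∀ δ : ℝ, 0 < δ → δ < 1 →
      1 - δ ≤ P.real {ω |
        risk ℓ ν (shb ℓ α β w₀ (fun t => Z t ω) (T + 1)) - optRisk ℓ ν
          ≤ C * (T : ℝ) ^ (max (p - 1) (1 - 2 * p)) * Real.log (T / δ) ^ 2} := by
  have hb : 0 < 1 - β := by linarith
  have h1p : 0 < 1 - p := by linarith
  set K : ℝ := 2 * ((L : ℝ) + 1) with hKdef
  have hK : 0 < K := by positivity
  have hLK : 2 * (L : ℝ) ≤ K := by rw [hKdef]; linarith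
  set k := growthConst β K M with hk
  have hk0 : 0 < k := growthConst_pos hK hM
  set e := c₂ / (1 - β) with he
  have he0 : 0 < e := div_pos hc₂ hb
  set E₂ := e ^ 2 / (1 - p) with hE₂
  have hE₂0 : 0 < E₂ := by positivity
  set E₁ := e * (1 + R ^ 2) + 2 * M * E₂ with hE₁
  have hE₁0 : 0 < E₁ := by positivity
  -- E₁ bounds a step times 1 + V along every path, so this r meets the smallness condition for the
  -- exponential moment.
  set r := 1 / (18 * E₁ * k) with hr
  have hr0 : 0 < r := by positivity
  obtain ⟨S, hS⟩ := exists_sum_range_rpow_le hp₀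
  set r' := r * Real.exp (-((2 * curvConst β K * M + 12 * r * k * M) * (e ^ 2 * S))) with hr'
  have hr'0 : 0 < r' := by positivity
  -- As Λ > 1/2, the first summand cancels the initial moment r(1 + R²); the 3 leaves a tail
  -- exp(-3Λ) = (δ/T)³, ample for a union over T + 1 indices.
  set b := (2 * (r * (1 + R ^ 2)) + 3) / r' with hbdef
  have hb0 : 0 < b := by positivity
  set c := β / (1 - β) with hc
  set C₁ := 2 + e + e * (K * c ^ 2) + E₂ * (1 / 2 * (K * c) ^ 2) with hC₁
  have hC₁0 : 0 < C₁ := by positivity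
  set C₂ := b * (16 * E₂ * K * k + 2 * C₁ + 3 * ((K / 2 + 1) * (2 * K * k)) * (e ^ 3 / (1 - p)))
    with hC₂
  have hC₂0 : 0 < C₂ := by positivity
  set c' := c₁ / (1 - β) with hc'
  have hc'0 : 0 < c' := div_pos hc₁ hb
  refine ⟨(2 + K * c ^ 2) * (C₂ / c'), by positivity, ?_⟩
  intro d 𝒵 _ ν _ ℓ h v hopt hv w₀ hw₀ α haα hαb Ω _ P _ Z hZ hind hlaw T hT δ hδ₀ hδ₁
  clear_value C₂ C₁ b r' r E₁ E₂ k K c c' e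
  have hmin : ∀ w, risk ℓ ν v ≤ risk ℓ ν w := fun w => hopt.trans_le (h.optRisk_le w)
  have hηlow : ∀ n : ℕ, c' * ((n + 1 : ℕ) : ℝ) ^ (-p) ≤ α (n + 1) / (1 - β) := fun n => by
    rw [hc', div_mul_eq_mul_div]
    exact div_le_div_of_nonneg_right (hαb (n + 1) (by omega)).1 hb.le
  have hηup : ∀ n : ℕ, α (n + 1) / (1 - β) ≤ e * ((n + 1 : ℕ) : ℝ) ^ (-p) := fun n => by
    rw [he, div_mul_eq_mul_div]
    exact div_le_div_of_nonneg_right (hαb (n + 1) (by omega)).2 hb.le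
  have hη₀ : ∀ n : ℕ, 0 ≤ α (n + 1) / (1 - β) := fun n =>
    (by positivity : 0 ≤ c' * ((n + 1 : ℕ) : ℝ) ^ (-p)).trans (hηlow n)
  have hα : ∀ n, 0 ≤ α (n + 1) := fun n => by
    have := mul_nonneg (hη₀ n) hb.le
    rwa [div_mul_cancel₀ _ hb.ne'] at this
  have hηe : ∀ n, α (n + 1) / (1 - β) ≤ e := fun n => by
    refine (hηup n).trans (mul_le_of_le_one_right he0.le ?_)
    exact Real.rpow_le_one_of_one_le_of_nonpos (by exact_mod_cast Nat.succ_pos n) (by linarith)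
  have hQη := stepSum_mul_step_le hp₀ hp he0.le hη₀ hηup
  simp only [← hE₂] at hQη
  have hQmono : ∀ n, stepSum α β n ≤ stepSum α β (n + 1) := fun n => by
    have : stepSum α β (n + 1) = stepSum α β n + α (n + 1) / (1 - β) :=
      Finset.sum_range_succ _ _
    linarith [hη₀ n]
  have hw₀sq : ‖w₀ - v‖ ^ 2 ≤ R ^ 2 := pow_le_pow_left₀ (norm_nonneg _) hw₀ 2
  have hηV : ∀ (ζ : ℕ → 𝒵) n,
      α (n + 1) / (1 - β) * (1 + shbLyapunov ℓ α β w₀ v ζ n) ≤ E₁ := fun ζ n => by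
    have h1 := h.shbLyapunov_le (w₀ := w₀) hβ₀ hβ₁ hLK hK hv hα haα ζ n
    have h2 := mul_le_mul_of_nonneg_left
      (by linarith : 1 + shbLyapunov ℓ α β w₀ v ζ n ≤ (1 + R ^ 2) + 2 * M * stepSum α β n) (hη₀ n)
    have h3 : 2 * M * (stepSum α β n * (α (n + 1) / (1 - β))) ≤ 2 * M * E₂ :=
      mul_le_mul_of_nonneg_left ((mul_le_mul_of_nonneg_right (hQmono n) (hη₀ n)).trans (hQη n))
        (by positivity)
    have h4 : α (n + 1) / (1 - β) * (1 + R ^ 2) ≤ e * (1 + R ^ 2) :=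
      mul_le_mul_of_nonneg_right (hηe n) (by positivity)
    rw [hE₁]
    linarith
  have hsmall : ∀ (ζ : ℕ → 𝒵) n, 18 * r * (α (n + 1) / (1 - β)) * k
      * (1 + shbLyapunov ℓ α β w₀ v ζ n) ≤ 1 := fun ζ n => by
    have h1 := mul_le_mul_of_nonneg_left (hηV ζ n) (by positivity : 0 ≤ 18 * r * k)
    have h2 : 18 * r * k * E₁ = 1 := by rw [hr]; field_simp
    linarith
  have hSη : ∀ n, ∑ s ∈ Finset.range n, (α (s + 1) / (1 - β)) ^ 2 ≤ e ^ 2 * S := fun n => by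
    refine le_trans ?_ (mul_le_mul_of_nonneg_left (hS n) (sq_nonneg e))
    rw [Finset.mul_sum]
    refine Finset.sum_le_sum fun s _ => ?_
    rw [← mul_pow]
    exact pow_le_pow_left₀ (hη₀ s) (hηup s) 2
  have hT' : (2 : ℝ) ≤ T := by exact_mod_cast hT
  have hT0 : (0 : ℝ) < T := by linarith
  set Λ := Real.log (T / δ) with hΛ
  have hTδ : (T : ℝ) ≤ T / δ := by
    rw [le_div_iff₀ hδ₀]
    exact mul_le_of_le_one_right hT0.le hδ₁.le
  have hlogT : Real.log T ≤ Λ := Real.log_le_log hT0 hTδ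
  have hlog2 : 1 / 2 < Λ := by
    have h1 : Real.log 2 ≤ Real.log T := Real.log_le_log two_pos hT'
    linarith [Real.log_two_gt_d9]
  have hΛ0 : 0 < Λ := by linarith
  have hexpΛ : Real.exp (-Λ) = δ / T := by
    rw [Real.exp_neg, hΛ, Real.exp_log (by positivity), inv_div]
  set B := b * Λ with hB
  have hB0 : 0 < B := by positivity
  -- The largest exponent the noise bound allows, since Q times a step is at most E₂. It is of order
  -- 1/B, so the noise is O(BΛ) = O(Λ²).
  set q := 1 / (16 * E₂ * K * k * B) with hq
  have hq0 : 0 < q := by positivity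
  clear_value q B Λ
  have htail : ∀ n, P {ω | B < 1 + shbLyapunov ℓ α β w₀ v (fun t => Z t ω) n
      + shbEnergy ℓ ν α β w₀ v (fun t => Z t ω) n} ≤ ENNReal.ofReal ((δ / T) ^ 3) := fun n => by
    refine (h.measure_lt_shbLyapunov_le hβ₀ hβ₁ hLK hK hM hv hmin hα haα hr0.le
      (by simpa only [hk] using hsmall) hSη hw₀sq hB0.le hZ hind hlaw n).trans (ENNReal.ofReal_le_ofReal ?_)
    rw [← hexpΛ, ← Real.exp_nat_mul]
    refine Real.exp_le_exp.2 ?_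
    have h1 : r' * B = (2 * (r * (1 + R ^ 2)) + 3) * Λ := by
      rw [hB, hbdef]; field_simp
    have h2 : 0 ≤ r * (1 + R ^ 2) := by positivity
    have h3 : r * (1 + R ^ 2) ≤ 2 * (r * (1 + R ^ 2)) * Λ := by nlinarith
    rw [← hk, ← hr', h1]
    push_cast
    linarith
  have hnoise : P {ω | Λ < q * shbNoise ℓ ν α β w₀ v B (fun t => Z t ω) T}
      ≤ ENNReal.ofReal (δ / T) := by
    have h1 := h.lintegral_exp_shbNoise_le_one (w₀ := w₀) (r := q) (B := B) hβ₀ hβ₁ hLK hK hM hv hα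
      hq0.le
      (fun n => by
        have h1 := mul_le_mul_of_nonneg_left (hQη n) (by positivity : 0 ≤ 16 * q * K * k * B)
        have h2 : 16 * q * K * k * B * E₂ = 1 := by rw [hq]; field_simp
        rw [← hk]
        linarith) hZ hind hlaw T
    have hm := ((h.measurable_shbNoise (Z := Z) α β w₀ v B T).mono
      (strictPast_le hZ (T + 1)) le_rfl).const_mul q
    have := measure_lt_le_of_lintegral_exp_le (P := P) hm (b := 0) (x := Λ)
      (by simpa using h1)
    rwa [zero_sub, hexpΛ] at this
  set bad : Set Ω := (⋃ n ∈ Finset.range (T + 1), {ω | B < 1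
      + shbLyapunov ℓ α β w₀ v (fun t => Z t ω) n + shbEnergy ℓ ν α β w₀ v (fun t => Z t ω) n})
    ∪ {ω | Λ < q * shbNoise ℓ ν α β w₀ v B (fun t => Z t ω) T} with hbad
  have hPbad : P bad ≤ ENNReal.ofReal δ := by
    have h1 : P (⋃ n ∈ Finset.range (T + 1), {ω | B < 1
        + shbLyapunov ℓ α β w₀ v (fun t => Z t ω) n
        + shbEnergy ℓ ν α β w₀ v (fun t => Z t ω) n})
        ≤ ENNReal.ofReal ((T + 1) * (δ / T) ^ 3) := by
      refine (measure_biUnion_finset_le _ _).trans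
        ((Finset.sum_le_card_nsmul _ _ _ fun n _ => htail n).trans_eq ?_)
      rw [Finset.card_range, nsmul_eq_mul, ENNReal.ofReal_mul (by positivity)]
      congr 1
      rw [← Nat.cast_succ, ENNReal.ofReal_natCast]
    refine (measure_union_le _ _).trans ((add_le_add h1 hnoise).trans ?_)
    rw [← ENNReal.ofReal_add (by positivity) (by positivity)]
    refine ENNReal.ofReal_le_ofReal ?_
    have hx : δ / T ≤ δ / 2 := by gcongr
    have hx0 : 0 < δ / T := by positivity
    have hxT : T * (δ / T) = δ := by field_simp
    have h3 : (δ / T) ^ 2 ≤ 1 / 4 := by nlinarith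
    have h4 : (T + 1) * (δ / T) ≤ 3 / 2 * δ := by linarith
    have h5 : (T + 1) * (δ / T) ^ 3 = (T + 1) * (δ / T) * (δ / T) ^ 2 := by ring
    have h6 : (T + 1) * (δ / T) * (δ / T) ^ 2 ≤ 3 / 2 * δ * (1 / 4) :=
      mul_le_mul h4 h3 (sq_nonneg _) (by positivity)
    linarith
  set good : Set Ω := {ω |
        risk ℓ ν (shb ℓ α β w₀ (fun t => Z t ω) (T + 1)) - optRisk ℓ ν
          ≤ (2 + K * c ^ 2) * (C₂ / c') * (T : ℝ) ^ (max (p - 1) (1 - 2 * p)) * Λ ^ 2} with hgood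
  have hsub : goodᶜ ⊆ bad := by
    intro ω hω
    by_contra hnb
    refine hω ?_
    simp only [hbad, Set.mem_union, Set.mem_iUnion, Set.mem_ofPred_eq, not_or, not_exists,
      not_lt, Finset.mem_range] at hnb
    obtain ⟨hW, hN⟩ := hnb
    set ζ : ℕ → 𝒵 := fun t => Z t ω
    have hJ₀ := shbEnergy_nonneg (w₀ := w₀) hβ₁ hmin hα ζ
    have hV₀ : 0 ≤ shbLyapunov ℓ α β w₀ v ζ T := lyapunov_nonneg hβ₁ _ _ _
    -- Off the bad event the truncation never acts, so `shbNoise` is the actual noise.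
    have hdet := h.stepSum_mul_le (w₀ := w₀) hβ₀ hβ₁ hLK hK hM hv hmin hα hQη hηe ζ (n := T)
      (B := B) (fun s hs => by linarith [hW s (by omega), hJ₀ s])
    have hWT : shbEnergy ℓ ν α β w₀ v ζ T ≤ B := by linarith [hW T (by omega)]
    have hNT : shbNoise ℓ ν α β w₀ v B ζ T ≤ 16 * E₂ * K * k * B * Λ := by
      have h1 := mul_le_mul_of_nonneg_left hN (by positivity : 0 ≤ 16 * E₂ * K * k * B)
      have h2 : 16 * E₂ * K * k * B * (q * shbNoise ℓ ν α β w₀ v B ζ T)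
          = shbNoise ℓ ν α β w₀ v B ζ T := by rw [hq]; field_simp
      linarith
    have hsum := sum_stepSum_mul_sq_le (by linarith) hp he0.le hη₀ hηup T
    have hQT := le_stepSum (p := p) (by linarith) hc'0.le hηlow (n := T) (by omega)
    rw [← hk, ← hc, ← hC₁] at hdet
    set x := max 0 (2 - 3 * p) with hx
    have hTx : 1 ≤ (T : ℝ) ^ x := Real.one_le_rpow (by linarith) (le_max_left _ _)
    have hcmp := (h.hasQuadraticUpperBound_risk hLK).sub_le_two_mul hK hmin
      (auxPoint β (shb ℓ α β w₀ ζ T) (shb ℓ α β w₀ ζ (T + 1))) (shb ℓ α β w₀ ζ (T + 1))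
    rw [show shb ℓ α β w₀ ζ (T + 1) - auxPoint β (shb ℓ α β w₀ ζ T) (shb ℓ α β w₀ ζ (T + 1))
      = -((β / (1 - β)) • (shb ℓ α β w₀ ζ (T + 1) - shb ℓ α β w₀ ζ T)) by simp [auxPoint],
      norm_neg, norm_smul, mul_pow, Real.norm_eq_abs, sq_abs, ← hc] at hcmp
    have hA₀ := sub_nonneg.2 (hmin
      (auxPoint β (shb ℓ α β w₀ ζ T) (shb ℓ α β w₀ ζ (T + 1))))
    set A := risk ℓ ν (auxPoint β (shb ℓ α β w₀ ζ T) (shb ℓ α β w₀ ζ (T + 1))) - risk ℓ ν v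
    set m := ‖shb ℓ α β w₀ ζ (T + 1) - shb ℓ α β w₀ ζ T‖ ^ 2 with hm
    have hm₀ : 0 ≤ m := sq_nonneg _
    have hbound : stepSum α β T * (A + m) ≤ C₂ * Λ ^ 2 * (T : ℝ) ^ x := by
      have hΛx : Λ ≤ Λ * (T : ℝ) ^ x := le_mul_of_one_le_right hΛ0.le hTx
      have h1 : 16 * E₂ * K * k * B * Λ ≤ 16 * E₂ * K * k * B * (Λ * (T : ℝ) ^ x) := by gcongr
      have h2 : C₁ * shbEnergy ℓ ν α β w₀ v ζ T ≤ 2 * C₁ * B * (Λ * (T : ℝ) ^ x) := by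
        have h21 : C₁ * shbEnergy ℓ ν α β w₀ v ζ T ≤ C₁ * B := by gcongr
        have h22 : C₁ * B * 1 ≤ C₁ * B * (2 * (Λ * (T : ℝ) ^ x)) := by
          gcongr
          linarith
        linarith
      have h3 : (T : ℝ) ^ x * (1 + Real.log T) ≤ 3 * (Λ * (T : ℝ) ^ x) := by
        have : (T : ℝ) ^ x * (1 + Real.log T) ≤ (T : ℝ) ^ x * (3 * Λ) := by
          gcongr
          linarith
        linarith
      have h4 : (K / 2 + 1) * (2 * K * k * B)
          * ∑ s ∈ Finset.range T, stepSum α β (s + 1) * (α (s + 1) / (1 - β)) ^ 2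
          ≤ (K / 2 + 1) * (2 * K * k * B) * (e ^ 3 / (1 - p) * (3 * (Λ * (T : ℝ) ^ x))) := by
        refine mul_le_mul_of_nonneg_left (hsum.trans ?_) (by positivity)
        gcongr
      refine hdet.trans ((add_le_add (add_le_add (hNT.trans h1) h2) h4).trans_eq ?_)
      rw [hC₂, hB]
      ring
    have hAm : A + m ≤ C₂ / c' * (T : ℝ) ^ (max (p - 1) (1 - 2 * p)) * Λ ^ 2 := by
      -- Dividing by T^(1-p) turns the exponents 0 and 2-3p into p-1 and 1-2p.
      have hpow : (T : ℝ) ^ x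
          = (T : ℝ) ^ (1 - p) * (T : ℝ) ^ (max (p - 1) (1 - 2 * p)) := by
        rw [← Real.rpow_add hT0, hx]
        congr 1
        rw [← max_add_add_left]
        congr 1 <;> ring
      have hTp : 0 < (T : ℝ) ^ (1 - p) := by positivity
      have h1 := (mul_le_mul_of_nonneg_right hQT (add_nonneg hA₀ hm₀)).trans hbound
      rw [hpow] at h1
      have h2 : c' * (T : ℝ) ^ (1 - p) * (A + m) ≤ c' * (T : ℝ) ^ (1 - p)
          * (C₂ / c' * (T : ℝ) ^ (max (p - 1) (1 - 2 * p)) * Λ ^ 2) := by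
        refine h1.trans_eq ?_
        field_simp
      exact le_of_mul_le_mul_left h2 (by positivity)
    have hfin : risk ℓ ν (shb ℓ α β w₀ ζ (T + 1)) - risk ℓ ν v ≤ (2 + K * c ^ 2) * (A + m) := by
      have h1 : 0 ≤ K * c ^ 2 * A := by positivity
      linarith
    have := hfin.trans (mul_le_mul_of_nonneg_left hAm (by positivity : 0 ≤ 2 + K * c ^ 2))
    rw [hgood, Set.mem_ofPred_eq, ← hopt]
    linarith
  have h1 : (1 : ENNReal) ≤ P good + ENNReal.ofReal δ := by
    rw [← measure_univ (μ := P), ← Set.union_compl_self good]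
    exact (measure_union_le _ _).trans (add_le_add le_rfl ((measure_mono hsub).trans hPbad))
  have h2 := ENNReal.toReal_mono (by finiteness) h1
  rw [ENNReal.toReal_one, ENNReal.toReal_add (by finiteness) (by finiteness),
    ENNReal.toReal_ofReal hδ₀.le] at h2
  rw [measureReal_def]
  linarith

end Main

theorem theoremt (L : ℝ≥0) (β : ℝ) (hβ₀ : 0 ≤ β) (hβ₁ : β < 1) :
    -- the step-size threshold depends only on `L` and `β`
    ∃ a₀ : ℝ, 0 < a₀ ∧
    ∀ (p c₁ c₂ M R : ℝ), 1 / 2 < p → p < 1 → 0 < c₁ →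
    -- the constant depends only on `L, β, p, c₁, c₂`, the bound `M` on `ℓ(·, w_*)`
    -- and the bound `R` on the initial distance to `w_*`
    ∃ C : ℝ, 0 < C ∧
    ∀ (d : ℕ) (𝒵 : Type u) [MeasurableSpace 𝒵] (ν : Measure 𝒵) [IsProbabilityMeasure ν]
      (ℓ : 𝒵 → Param d → ℝ), IsSmoothConvexLoss ℓ ν L →
    ∀ wstar : Param d, risk ℓ ν wstar = optRisk ℓ ν → (∀ z, ℓ z wstar ≤ M) →
    ∀ w₀ : Param d, ‖w₀ - wstar‖ ≤ R →
    ∀ α : ℕ → ℝ, α 0 ≤ a₀ → (∀ t, α (t + 1) ≤ α t) →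
      (∀ t : ℕ, 1 ≤ t → c₁ * (t : ℝ) ^ (-p) ≤ α t ∧ α t ≤ c₂ * (t : ℝ) ^ (-p)) →
    ∀ (Ω : Type v) [MeasurableSpace Ω] (P : Measure Ω) [IsProbabilityMeasure P]
      (Z : ℕ → Ω → 𝒵), (∀ t, Measurable (Z t)) → iIndepFun Z P → (∀ t, P.map (Z t) = ν) →
    ∀ T : ℕ, 2 ≤ T → ∀ δ : ℝ, 0 < δ → δ < 1 →
      1 - δ ≤ P.real {ω |
        risk ℓ ν (shb ℓ α β w₀ (fun t => Z t ω) (T + 1)) - optRisk ℓ ν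
          ≤ C * (T : ℝ) ^ (max (p - 1) (1 - 2 * p)) * Real.log (T / δ) ^ 2} := by
  have hb : 0 < 1 - β := by linarith
  have ha := curvConst_pos (β := β) (K := 2 * ((L : ℝ) + 1)) (by positivity)
  refine ⟨(1 - β) / (4 * curvConst β (2 * ((L : ℝ) + 1))), by positivity, ?_⟩
  intro p c₁ c₂ M R hp₀ hp hc₁
  -- Enlarging c₂ and M weakens the hypotheses on α and on the loss, and supplies the required
  -- signs.
  obtain ⟨C, hC, hmain⟩ := exists_shb_rate.{u, v} L hβ₀ hβ₁ (c₂ := max c₂ 1) (M := max M 0)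
    (R := R) hp₀ hp hc₁ (by positivity) (le_max_right _ _)
  refine ⟨C, hC, ?_⟩
  intro d 𝒵 _ ν _ ℓ h wstar hopt hM w₀ hw₀ α hα₀ hanti hα Ω _ P _ Z hZ hind hlaw
  refine hmain d 𝒵 ν ℓ h wstar hopt (fun z => (hM z).trans (le_max_left _ _)) w₀
    hw₀ α (fun n => ?_)
    (fun t ht => ⟨(hα t ht).1, (hα t ht).2.trans ?_⟩) Ω P Z hZ hind hlaw
  · have h1 : α (n + 1) ≤ (1 - β) / (4 * curvConst β (2 * ((L : ℝ) + 1))) :=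
      (antitone_nat_of_succ_le hanti (Nat.zero_le (n + 1))).trans hα₀
    rw [le_div_iff₀ (by positivity)] at h1
    rw [← mul_div_assoc, div_le_iff₀ hb]
    linarith
  · exact mul_le_mul_of_nonneg_right (le_max_left _ _) (by positivity)
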